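/- Let $\mathbb F$ be an algebraically closed field of characteristic not $2$. **Setting.** For a graph $\Gamma$ with vertex set $\{1,\dots,n\}$, let $\mathcal F_\Gamma$ be the quotient of the free Lie algebra over $\mathbb F$ on $x_1,\dots,x_n$ by the ideal generated by all $[x_i,x_j]$ with $\{i,j\}$ not an edge of $\Gamma$. For a family $f=(f_1,\dots,f_n)$ of linear functionals on $\mathcal F_\Gamma$, let $\mathcal L_\Gamma(f)$ be the quotient of $\mathcal F_\Gamma$ by the ideal generated by all $[x_i,[x_i,y]]-f_i(y)\,x_i$ with $1\le i\le n$ and $y\in\mathcal F_\Gamma$. A monomial of length $\ell$ is a bracketed product of $\ell$ generators, with any bracketing. A product written without brackets is right-normed: $x_{i_1}x_{i_2}\cdots x_{i_k}=[x_{i_1},[x_{i_2},\dots,[x_{i_{k-1}},x_{i_k}]\dots]]$. The graph $\Gamma_{C;n}$ is the path $1-2-\cdots-n$. The graph $\Gamma_{A;n}$ is this path with the additional edge $\{1,3\}$ (if $n\ge 3$). The graph $\Gamma_{D;n}$ is $\Gamma_{A;n}$ with the additional edge $\{n-2,n\}$, and $\Gamma_{B;n}$ is $\Gamma_{D;n}$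 without the edge $\{n-1,n\}$. **Notation.** For $i\le j$ write $x_{i\uparrow j}=x_ix_{i+1}\cdots x_j$ and $x_{j\downarrow i}=x_jx_{j-1}\cdots x_i$; when $j=i-1$ such a factor inside a longer product is empty. For $i\le j$ write $x_{j\uparrow\Downarrow i}=x_jx_{j+1}\,x_{j-1}x_j\,x_{j-2}x_{j-1}\cdots x_{i+1}x_{i+2}\,x_i$. These denote strings of factors; concatenated strings are read as one right-normed product. **The lists.** For $n\ge5$ let $\mathcal M_{D;n}$ be the set of the following monomials: $$\begin{aligned} y^1_{k,m}&=x_{k\downarrow m}, & n\ge k\ge m\ge1,\\ y^2_{k,m}&=x_{k\uparrow n-2}\,x_{n\downarrow m}, & n-2\ge k>m\ge1,\\ y^3_{k,m}&=x_{k\downarrow m+1}\,x_{m-1\uparrow\Downarrow1}, & n\ge k\ge m\ge3,\\ y^4_{k,m}&=x_{k\uparrow n-2}\,x_{n\downarrow m+1}\,x_{m-1\uparrow\Downarrow1}, & n-2\ge k\ge m\ge3,\\ y^5_m&=x_n\,x_{n-2\downarrow m}, & n-2\ge m\ge1,\\ y^6_m&=x_{n-1}x_n\,x_{n-2\downarrow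 m}, & n-2\ge m\ge1,\\ y^7_k&=x_{k\downarrow3}\,x_1, & n\ge k\ge3,\\ y^8_k&=x_{k\uparrow n-2}\,x_{n\downarrow3}\,x_1, & n-2\ge k\ge2,\\ y^9_m&=x_n\,x_{n-2\downarrow m+1}\,x_{m-1\uparrow\Downarrow1}, & n-2\ge m\ge3,\\ y^{10}_m&=x_{n-1}x_n\,x_{n-2\downarrow m+1}\,x_{m-1\uparrow\Downarrow1}, & n-2\ge m\ge3,\\ y^{11}&=x_1\,x_{3\uparrow n-2}\,x_{n\downarrow1}, &\\ y^{12}&=x_1\,x_{3\uparrow n-2}\,x_{n\downarrow2}, &\\ y^{13}&=x_n\,x_{n-2\downarrow3}\,x_1, &\\ y^{14}&=x_{n-1}x_n\,x_{n-2\downarrow3}\,x_1, &\\ y^{15}&=x_{n-2}x_n\,x_{n-3\uparrow\Downarrow1}, &\\ y^{16}&=x_{n-1}x_{n-2}x_n\,x_{n-3\uparrow\Downarrow1}, &\\ y^{17}&=x_nx_{n-1}x_{n-2}x_n\,x_{n-3\uparrow\Downarrow1}. & \end{aligned}$$ For $n\ge5$ let $\mathcal M_{B;n}$ be $\mathcal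 M_{D;n}$ without $y^1_{n,n-1}$, $y^3_{n,n}$, all $y^6_m$ ($n-2\ge m\ge1$), all $y^{10}_m$ ($n-2\ge m\ge3$), $y^{12}$, $y^{14}$ and $y^{17}$. For $n\ge2$ let $\mathcal M_{A;n}$ consist of the $y^1_{k,m}$ ($n\ge k\ge m\ge1$), the $y^3_{k,m}$ ($n\ge k\ge m\ge3$) and the $y^7_k$ ($n\ge k\ge3$). For $n\ge1$ let $\mathcal M_{C;n}$ consist of the $y^1_{k,m}$ ($n\ge k\ge m\ge1$). **Theorem.** Let $(X,n)$ be one of $(D,n)$ with $n\ge5$, $(B,n)$ with $n\ge5$, $(A,n)$ with $n\ge2$, or $(C,n)$ with $n\ge1$. Then for every family $f$ of linear functionals on $\mathcal F_{\Gamma_{X;n}}$ and every monomial $x$ of length $\ell$ in $x_1,\dots,x_n$, the image of $x$ in $\mathcal L_{\Gamma_{X;n}}(f)$ is a linear combination of the images of monomials $y\in\mathcal M_{X;n}$ of length at most $\ell$. Moreover, $\mathcal M_{D;n}$ consists of exactly $2n^2-n$ distinct words and $\mathcal M_{B;n}$ of exactly $2n^2-3n+1$ distinct words. -/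

import Mathlib

/-! ### Lie algebras attached to a graph -/

section GraphLieAlgebras

variable (𝔽 : Type*) [Field 𝔽] {V : Type*}

/-- The ideal of the free Lie algebra on `V` generated by the brackets `⁅x_i, x_j⁆` of
generators with `{i, j}` not an edge of `Γ`. -/
noncomputable def commutationIdeal (Γ : SimpleGraph V) : LieIdeal 𝔽 (FreeLieAlgebra 𝔽 V) :=
  LieSubmodule.lieSpan 𝔽 (FreeLieAlgebra 𝔽 V)
    {z | ∃ i j : V, ¬ Γ.Adj i j ∧ z = ⁅FreeLieAlgebra.of 𝔽 i, FreeLieAlgebra.of 𝔽 j⁆}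

/-- The Lie algebra `F_Γ`: generators `x_i` (`i ∈ V`), with `⁅x_i, x_j⁆ = 0` whenever
`{i, j}` is not an edge of `Γ`. -/
abbrev GraphLie (Γ : SimpleGraph V) : Type _ :=
  FreeLieAlgebra 𝔽 V ⧸ commutationIdeal 𝔽 Γ

/-- The standard generators of `F_Γ`. -/
noncomputable def graphGen (Γ : SimpleGraph V) (i : V) : GraphLie 𝔽 Γ :=
  LieSubmodule.Quotient.mk (FreeLieAlgebra.of 𝔽 i)

/-- The parameter space: families `f = (f_i)` of linear functionals on `F_Γ`. -/
abbrev GraphParam (Γ : SimpleGraph V) : Type _ :=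
  V → Module.Dual 𝔽 (GraphLie 𝔽 Γ)

/-- The ideal of `F_Γ` generated by all `⁅x_i, ⁅x_i, y⁆⁆ - f_i(y) x_i`. -/
noncomputable def extremalIdeal (Γ : SimpleGraph V) (f : GraphParam 𝔽 Γ) : LieIdeal 𝔽 (GraphLie 𝔽 Γ) :=
  LieSubmodule.lieSpan 𝔽 (GraphLie 𝔽 Γ)
    {z | ∃ (i : V) (y : GraphLie 𝔽 Γ),
      z = ⁅graphGen 𝔽 Γ i, ⁅graphGen 𝔽 Γ i, y⁆⁆ - f i y • graphGen 𝔽 Γ i}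

/-- The Lie algebra `L_Γ(f)`, the quotient of `F_Γ` in which every generator `x_i` is extremal
(or zero) with extremal functional `f_i`. -/
abbrev ExtremalLie (Γ : SimpleGraph V) (f : GraphParam 𝔽 Γ) : Type _ :=
  GraphLie 𝔽 Γ ⧸ extremalIdeal 𝔽 Γ f

/-- The standard generators of `L_Γ(f)`. -/
noncomputable def extremalGen (Γ : SimpleGraph V) (f : GraphParam 𝔽 Γ) (i : V) : ExtremalLie 𝔽 Γ f :=
  LieSubmodule.Quotient.mk (graphGen 𝔽 Γ i)

end GraphLieAlgebras

section Monomials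

variable {V L : Type*} [LieRing L]

/-- The value of a bracketed monomial when the letter `i` is given the value `x i`. Its length
is `FreeMagma.length`, the number of letters. -/
def monomialValue (x : V → L) : FreeMagma V → L
  | .of i => x i
  | .mul a b => ⁅monomialValue x a, monomialValue x b⁆

/-- The value of the right-normed monomial
`x_{i₁} x_{i₂} ⋯ x_{iₖ} = ⁅x_{i₁}, ⁅x_{i₂}, ⋯ x_{iₖ}⁆⁆` given by the word `[i₁, i₂, …, iₖ]`.
(The empty word is not a monomial; it gets the value `0`.) -/
def wordValue (x : V → L) : List V → L
  | [] => 0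
  | [i] => x i
  | i :: j :: w => ⁅x i, wordValue x (j :: w)⁆

end Monomials

/-- For every parameter `f`, every monomial in the generators of `L_Γ(f)` (with any bracketing)
is a linear combination of right-normed monomials from `M` that are not longer than it. -/
def SpansMonomialsByLength (𝔽 : Type*) [Field 𝔽] {V : Type*} (Γ : SimpleGraph V)
    (M : Set (List V)) : Prop :=
  ∀ (f : GraphParam 𝔽 Γ) (x : FreeMagma V),
    monomialValue (extremalGen 𝔽 Γ f) x ∈
      Submodule.span 𝔽
        {z : ExtremalLie 𝔽 Γ f | ∃ w ∈ M, w.length ≤ x.length ∧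
          z = wordValue (extremalGen 𝔽 Γ f) w}

/-! ### The four families of graphs -/

/-- The vertices are numbered `1, …, n`. -/
abbrev Vertex (n : ℕ) : Type := {i : ℕ // 1 ≤ i ∧ i ≤ n}

/-- The path `1 - 2 - ⋯ - n`. -/
def graphC (n : ℕ) : SimpleGraph (Vertex n) :=
  SimpleGraph.fromRel fun i j => j.1 = i.1 + 1

/-- The path `1 - 2 - ⋯ - n` with the additional edge `{1, 3}`. -/
def graphA (n : ℕ) : SimpleGraph (Vertex n) :=
  SimpleGraph.fromRel fun i j => j.1 = i.1 + 1 ∨ (i.1 = 1 ∧ j.1 = 3)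

/-- The path `1 - 2 - ⋯ - n` with the additional edges `{1, 3}` and `{n - 2, n}`. -/
def graphD (n : ℕ) : SimpleGraph (Vertex n) :=
  SimpleGraph.fromRel fun i j =>
    j.1 = i.1 + 1 ∨ (i.1 = 1 ∧ j.1 = 3) ∨ (i.1 + 2 = n ∧ j.1 = n)

/-- The path `1 - 2 - ⋯ - (n - 1)` with the additional edges `{1, 3}` and `{n - 2, n}`. -/
def graphB (n : ℕ) : SimpleGraph (Vertex n) :=
  SimpleGraph.fromRel fun i j =>
    (j.1 = i.1 + 1 ∧ j.1 ≠ n) ∨ (i.1 = 1 ∧ j.1 = 3) ∨ (i.1 + 2 = n ∧ j.1 = n)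

/-! ### The lists of monomials, as words in the indices of the generators -/

/-- The word `i, i + 1, …, j` (empty if `j < i`). -/
def up (i j : ℕ) : List ℕ := List.range' i (j + 1 - i)

/-- The word `j, j - 1, …, i` (empty if `j < i`). -/
def down (j i : ℕ) : List ℕ := (up i j).reverse

/-- The word `j, j + 1, j - 1, j, j - 2, j - 1, …, i + 1, i + 2, i`, for `i ≤ j`. -/
def upDown (j i : ℕ) : List ℕ := (down j (i + 1)).flatMap (fun k => [k, k + 1]) ++ [i]

/-- The seventeen classes of words. -/
def y1 (k m : ℕ) : List ℕ := down k m
def y2 (n k m : ℕ) : List ℕ := up k (n - 2) ++ down n m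
def y3 (k m : ℕ) : List ℕ := down k (m + 1) ++ upDown (m - 1) 1
def y4 (n k m : ℕ) : List ℕ := up k (n - 2) ++ down n (m + 1) ++ upDown (m - 1) 1
def y5 (n m : ℕ) : List ℕ := [n] ++ down (n - 2) m
def y6 (n m : ℕ) : List ℕ := [n - 1, n] ++ down (n - 2) m
def y7 (k : ℕ) : List ℕ := down k 3 ++ [1]
def y8 (n k : ℕ) : List ℕ := up k (n - 2) ++ down n 3 ++ [1]
def y9 (n m : ℕ) : List ℕ := [n] ++ down (n - 2) (m + 1) ++ upDown (m - 1) 1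
def y10 (n m : ℕ) : List ℕ := [n - 1, n] ++ down (n - 2) (m + 1) ++ upDown (m - 1) 1
def y11 (n : ℕ) : List ℕ := [1] ++ up 3 (n - 2) ++ down n 1
def y12 (n : ℕ) : List ℕ := [1] ++ up 3 (n - 2) ++ down n 2
def y13 (n : ℕ) : List ℕ := [n] ++ down (n - 2) 3 ++ [1]
def y14 (n : ℕ) : List ℕ := [n - 1, n] ++ down (n - 2) 3 ++ [1]
def y15 (n : ℕ) : List ℕ := [n - 2, n] ++ upDown (n - 3) 1
def y16 (n : ℕ) : List ℕ := [n - 1, n - 2, n] ++ upDown (n - 3) 1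
def y17 (n : ℕ) : List ℕ := [n, n - 1, n - 2, n] ++ upDown (n - 3) 1

def wordsD (n : ℕ) : Set (List ℕ) :=
  {w | (∃ k m, n ≥ k ∧ k ≥ m ∧ m ≥ 1 ∧ w = y1 k m) ∨
    (∃ k m, n - 2 ≥ k ∧ k > m ∧ m ≥ 1 ∧ w = y2 n k m) ∨
    (∃ k m, n ≥ k ∧ k ≥ m ∧ m ≥ 3 ∧ w = y3 k m) ∨
    (∃ k m, n - 2 ≥ k ∧ k ≥ m ∧ m ≥ 3 ∧ w = y4 n k m) ∨
    (∃ m, n - 2 ≥ m ∧ m ≥ 1 ∧ w = y5 n m) ∨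
    (∃ m, n - 2 ≥ m ∧ m ≥ 1 ∧ w = y6 n m) ∨
    (∃ k, n ≥ k ∧ k ≥ 3 ∧ w = y7 k) ∨
    (∃ k, n - 2 ≥ k ∧ k ≥ 2 ∧ w = y8 n k) ∨
    (∃ m, n - 2 ≥ m ∧ m ≥ 3 ∧ w = y9 n m) ∨
    (∃ m, n - 2 ≥ m ∧ m ≥ 3 ∧ w = y10 n m) ∨
    w = y11 n ∨ w = y12 n ∨ w = y13 n ∨ w = y14 n ∨ w = y15 n ∨ w = y16 n ∨ w = y17 n}

def wordsB (n : ℕ) : Set (List ℕ) :=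
  wordsD n \
    {w | w = y1 n (n - 1) ∨ w = y3 n n ∨
      (∃ m, n - 2 ≥ m ∧ m ≥ 1 ∧ w = y6 n m) ∨
      (∃ m, n - 2 ≥ m ∧ m ≥ 3 ∧ w = y10 n m) ∨
      w = y12 n ∨ w = y14 n ∨ w = y17 n}

def wordsA (n : ℕ) : Set (List ℕ) :=
  {w | (∃ k m, n ≥ k ∧ k ≥ m ∧ m ≥ 1 ∧ w = y1 k m) ∨
    (∃ k m, n ≥ k ∧ k ≥ m ∧ m ≥ 3 ∧ w = y3 k m) ∨
    (∃ k, n ≥ k ∧ k ≥ 3 ∧ w = y7 k)}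

def wordsC (n : ℕ) : Set (List ℕ) :=
  {w | ∃ k m, n ≥ k ∧ k ≥ m ∧ m ≥ 1 ∧ w = y1 k m}

/-- The words of `S`, read as words in the vertices `1, …, n`. -/
def onVertices (n : ℕ) (S : Set (List ℕ)) : Set (List (Vertex n)) :=
  {w | w.map Subtype.val ∈ S}

def monomialsD (n : ℕ) : Set (List (Vertex n)) := onVertices n (wordsD n)
def monomialsB (n : ℕ) : Set (List (Vertex n)) := onVertices n (wordsB n)
def monomialsA (n : ℕ) : Set (List (Vertex n)) := onVertices n (wordsA n)
def monomialsC (n : ℕ) : Set (List (Vertex n)) := onVertices n (wordsC n)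

/-! The proof has two independent halves.

Reduction to f = 0. Inside L[X], the Rees algebra of the filtration by length is spanned by y X^d
with y of length at most d. Modulo its ideal generated by X, the generators X ⊗ x_i satisfy ⁅x_i,
⁅x_i, v⁆⁆ = 0, because f_i(y) x_i is shorter than the word it replaces. A spanning statement in this
quotient, read off in the coefficient of X^l, says that a monomial of length l is a combination of
listed words of length l plus an element of length at most l - 1. Induction on l finishes
(`lengthFiltration_le_of_spansDegenerate`).

Degenerate case. In characteristic not 2 each generator becomes a sandwich: ⁅x_i, ⁅u, ⁅x_i, v⁆⁆⁆ = 0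
for all u and v (`lie_lie_lie_eq_zero`). It is then enough that the span S of the listed words
contains the generators and is stable under every ad x_i (`monomialValue_mem`). Stability in type D
is `SandwichD.lie_codeValue_mem`. With n = p + 2, the words are descending chains, ended by one
letter or by a zigzag, and words that descend from the top and then turn back upwards. A further
generator either prolongs such a word, or meets a copy of itself and gives zero, or is rewritten by
the Jacobi identity on one of the triangles {1,2,3} and {p,p+1,p+2}.

The graph of type D is symmetric in the letters p + 1 and p + 2, and the remaining words are images
of chains under this symmetry. So the same stability lemmas apply to the swapped generators, once
the swapped families are known to lie in S (`ContainsAllD.containsD_swapTop`). The only swapped word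
that is not immediate is x_p x_{p+1} x_{p+2} followed by a zigzag; `SandwichD.hard_relation` handles
it.

Types A and C follow from a larger D by setting the superfluous generators to zero. Type B follows
from D with the extra relation ⁅x_{n-1}, x_n⁆ = 0. The cardinalities come from a parametrization of
the words that is injective because a few elementary invariants separate them
(`codeWord_injective`). -/

/-! ### Iterated brackets -/

section Act

variable {G : Type*} [LieRing G]

/-- Apply the operators `ad x_i` for the letters `i` of a word, the last letter first. -/
def act (x : ℕ → G) (w : List ℕ) (v : G) : G := w.foldr (fun i v => ⁅x i, v⁆) v

@[simp] theorem act_nil (x : ℕ → G) (v : G) : act x [] v = v := rfl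

@[simp] theorem act_cons (x : ℕ → G) (i : ℕ) (w : List ℕ) (v : G) :
    act x (i :: w) v = ⁅x i, act x w v⁆ := rfl

@[simp] theorem act_append (x : ℕ → G) (w w' : List ℕ) (v : G) :
    act x (w ++ w') v = act x w (act x w' v) := by
  simp [act, List.foldr_append]

theorem act_add (x : ℕ → G) (w : List ℕ) (u v : G) :
    act x w (u + v) = act x w u + act x w v := by
  induction w with
  | nil => rfl
  | cons i w ih => simp [ih]

theorem act_neg (x : ℕ → G) (w : List ℕ) (v : G) : act x w (-v) = -act x w v := by
  induction w with
  | nil => rfl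
  | cons i w ih => simp [ih]

theorem act_sub (x : ℕ → G) (w : List ℕ) (u v : G) :
    act x w (u - v) = act x w u - act x w v := by
  rw [sub_eq_add_neg, act_add, act_neg, sub_eq_add_neg]

@[simp] theorem act_zero (x : ℕ → G) (w : List ℕ) : act x w 0 = 0 := by
  induction w with
  | nil => rfl
  | cons i w ih => simp [ih]

theorem act_congr {x x' : ℕ → G} {w : List ℕ} (h : ∀ i ∈ w, x i = x' i) (v : G) :
    act x w v = act x' w v := by
  induction w with
  | nil => rfl
  | cons i w ih =>
    rw [act_cons, act_cons, h i (by simp), ih fun j hj => h j (by simp [hj])]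

theorem wordValue_concat (x : ℕ → G) (w : List ℕ) (i : ℕ) :
    wordValue x (w ++ [i]) = act x w (x i) := by
  induction w with
  | nil => rfl
  | cons j w ih =>
    cases w with
    | nil => rfl
    | cons k w => simpa [wordValue] using congrArg (fun v => ⁅x j, v⁆) ih

theorem lie_comm_of {a b : G} (h : ⁅a, b⁆ = 0) (v : G) : ⁅a, ⁅b, v⁆⁆ = ⁅b, ⁅a, v⁆⁆ := by
  rw [leibniz_lie, h, zero_lie, zero_add]

theorem act_comm {x : ℕ → G} {w : List ℕ} {a : G} (h : ∀ i ∈ w, ⁅a, x i⁆ = 0) (v : G) :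
    ⁅a, act x w v⁆ = act x w ⁅a, v⁆ := by
  induction w with
  | nil => rfl
  | cons i w ih =>
    rw [act_cons, act_cons, lie_comm_of (h i (by simp)), ih fun j hj => h j (by simp [hj])]

/-! ### Ascending and descending words -/

theorem mem_up {i j s : ℕ} : s ∈ up i j ↔ i ≤ s ∧ s ≤ j := by
  simp [up, List.mem_range'_1]; omega

theorem mem_down {i j s : ℕ} : s ∈ down j i ↔ i ≤ s ∧ s ≤ j := by
  simp [down, mem_up]

theorem up_eq_nil {i j : ℕ} (h : j < i) : up i j = [] := by
  simp [up, show j + 1 - i = 0 by omega]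

theorem down_eq_nil {i j : ℕ} (h : j < i) : down j i = [] := by
  simp [down, up_eq_nil h]

theorem up_append {i s j : ℕ} (h : i ≤ s + 1) (h' : s ≤ j) :
    up i j = up i s ++ up (s + 1) j := by
  unfold up
  rw [show j + 1 - i = (s + 1 - i) + (j + 1 - (s + 1)) by omega, ← List.range'_append]
  simp only [one_mul]
  rw [show i + (s + 1 - i) = s + 1 by omega]

theorem down_append {i s j : ℕ} (h : i ≤ s + 1) (h' : s ≤ j) :
    down j i = down j (s + 1) ++ down s i := by
  simp [down, up_append h h']

theorem up_self (i : ℕ) : up i i = [i] := by simp [up]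

theorem down_self (i : ℕ) : down i i = [i] := by simp [down, up_self]

theorem up_cons {i j : ℕ} (h : i ≤ j) : up i j = i :: up (i + 1) j := by
  rw [up_append (s := i) (by omega) h, up_self]; rfl

theorem down_concat {m k : ℕ} (h : m ≤ k) : down k m = down k (m + 1) ++ [m] := by
  rw [down_append (s := m) (by omega) h, down_self]

theorem down_succ_cons {m k : ℕ} (h : m ≤ k + 1) : down (k + 1) m = (k + 1) :: down k m := by
  rw [down_append (s := k) h (by omega), down_self]; rfl

theorem act_up_split (x : ℕ → G) {i s j : ℕ} (h : i ≤ s + 1) (h' : s ≤ j) (v : G) :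
    act x (up i j) v = act x (up i s) (act x (up (s + 1) j) v) := by
  rw [up_append h h', act_append]

theorem act_down_split (x : ℕ → G) {i s j : ℕ} (h : i ≤ s + 1) (h' : s ≤ j) (v : G) :
    act x (down j i) v = act x (down j (s + 1)) (act x (down s i) v) := by
  rw [down_append h h', act_append]

theorem act_up_cons (x : ℕ → G) {i j : ℕ} (h : i ≤ j) (v : G) :
    act x (up i j) v = ⁅x i, act x (up (i + 1) j) v⁆ := by
  rw [up_cons h, act_cons]

theorem act_down_concat (x : ℕ → G) {m k : ℕ} (h : m ≤ k) (v : G) :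
    act x (down k m) v = act x (down k (m + 1)) ⁅x m, v⁆ := by
  rw [down_concat h, act_append]; rfl

theorem act_down_succ (x : ℕ → G) {m k : ℕ} (h : m ≤ k + 1) (v : G) :
    act x (down (k + 1) m) v = ⁅x (k + 1), act x (down k m) v⁆ := by
  rw [down_succ_cons h, act_cons]

theorem act_up_nil (x : ℕ → G) {i j : ℕ} (h : j < i) (v : G) : act x (up i j) v = v := by
  rw [up_eq_nil h, act_nil]

theorem act_down_nil (x : ℕ → G) {i j : ℕ} (h : j < i) (v : G) : act x (down j i) v = v := by
  rw [down_eq_nil h, act_nil]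

/-- The value of the word `x_{j + 1}x_{j + 2} x_j x_{j + 1} ⋯ x_2x_3 x_1`. -/
def zigzag (x : ℕ → G) : ℕ → G
  | 0 => x 1
  | j + 1 => ⁅x (j + 2), ⁅x (j + 3), zigzag x j⁆⁆

/-- Indices `i`, `j` that are not joined in the graph of type `D` on `p + 2` vertices. -/
def Far (p i j : ℕ) : Prop := i = j ∨ i ≤ p + 2 ∧ j ≤ p + 2 ∧ (
  (i + 2 ≤ j ∧ ¬(i = 1 ∧ j = 3) ∧ ¬(i = p ∧ j = p + 2)) ∨
    (j + 2 ≤ i ∧ ¬(j = 1 ∧ i = 3) ∧ ¬(j = p ∧ i = p + 2)))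

/-- The relations satisfied by the generators in the degenerate Lie algebra of type `D` on
`p + 2` vertices. -/
structure SandwichD (p : ℕ) (x : ℕ → G) : Prop where
  three_le : 3 ≤ p
  comm : ∀ i j, Far p i j → ⁅x i, x j⁆ = 0
  sq : ∀ i (v : G), ⁅x i, ⁅x i, v⁆⁆ = 0
  sand : ∀ i (u v : G), ⁅x i, ⁅u, ⁅x i, v⁆⁆⁆ = 0

namespace SandwichD

variable {p : ℕ} {x : ℕ → G}

/-- The two sides differ by ⁅x_i, ⁅⁅a, b⁆, ⁅x_i, v⁆⁆⁆, which the sandwich property kills. Hence two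
factors enclosed by equal letters may be exchanged. -/
theorem swap (R : SandwichD p x) (i : ℕ) (a b v : G) :
    ⁅x i, ⁅a, ⁅b, ⁅x i, v⁆⁆⁆⁆ = ⁅x i, ⁅b, ⁅a, ⁅x i, v⁆⁆⁆⁆ := by
  rw [leibniz_lie a b, lie_add, R.sand, zero_add]

theorem lcomm (R : SandwichD p x) {i j : ℕ} (h : Far p i j) (v : G) :
    ⁅x i, ⁅x j, v⁆⁆ = ⁅x j, ⁅x i, v⁆⁆ :=
  lie_comm_of (R.comm i j h) v

theorem down_comm (R : SandwichD p x) {i k m : ℕ} (h : ∀ s, m ≤ s → s ≤ k → Far p i s) (v : G) :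
    ⁅x i, act x (down k m) v⁆ = act x (down k m) ⁅x i, v⁆ :=
  act_comm (fun s hs => R.comm _ _ (h s (mem_down.1 hs).1 (mem_down.1 hs).2)) v

theorem up_comm (R : SandwichD p x) {i k m : ℕ} (h : ∀ s, m ≤ s → s ≤ k → Far p i s) (v : G) :
    ⁅x i, act x (up m k) v⁆ = act x (up m k) ⁅x i, v⁆ :=
  act_comm (fun s hs => R.comm _ _ (h s (mem_up.1 hs).1 (mem_up.1 hs).2)) v

/-- The letter i passes everything above i + 1 and then meets x_{i+1} x_i, a sandwich. The excluded
cases are those where the extra edges {1, 3} and {p, p + 2} can block the passage. -/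
theorem down_kill (R : SandwichD p x) {i k m : ℕ} (h2 : 2 ≤ i) (hm : m ≤ i) (hk : i + 1 ≤ k)
    (hkp : k ≤ p + 2) (h : ¬(i = p ∧ k = p + 2)) (v : G) : ⁅x i, act x (down k m) v⁆ = 0 := by
  obtain ⟨i, rfl⟩ : ∃ i', i = i' + 1 := ⟨i - 1, by omega⟩
  rw [act_down_split x (s := i + 1 + 1) (by omega) (by omega), act_down_succ x (by omega),
    act_down_succ x (by omega), R.down_comm (by unfold Far; omega), R.sand, act_zero]

theorem down_self (R : SandwichD p x) {i m : ℕ} (h1 : 1 ≤ i) (hm : m ≤ i) (v : G) :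
    ⁅x i, act x (down i m) v⁆ = 0 := by
  obtain ⟨i, rfl⟩ : ∃ i', i = i' + 1 := ⟨i - 1, by omega⟩
  rw [act_down_succ x (by omega), R.sq]

theorem up_kill (R : SandwichD p x) {i k : ℕ} (h2 : 2 ≤ k) (hm : k + 1 ≤ i) (hip : i ≤ p)
    (v : G) : ⁅x i, act x (up k p) v⁆ = 0 := by
  obtain ⟨i, rfl⟩ : ∃ i', i = i' + 2 := ⟨i - 2, by omega⟩
  rw [act_up_split x (s := i) (by omega) (by omega), act_up_cons x (i := i + 1) (by omega),
    act_up_cons x (i := i + 1 + 1) (by omega), R.up_comm (by unfold Far; omega), R.sand, act_zero]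

theorem up_self (R : SandwichD p x) {i k : ℕ} (h1 : i ≤ k) (v : G) :
    ⁅x i, act x (up i k) v⁆ = 0 := by
  rw [act_up_cons x h1, R.sq]

/-! ### The action of the generators on zigzags -/

theorem zigzag_far (R : SandwichD p x) {i j : ℕ} (h : j + 4 ≤ i) (h' : ¬(j + 2 = p ∧ i = p + 2))
    (hip : i ≤ p + 2) : ⁅x i, zigzag x j⁆ = 0 := by
  induction j with
  | zero => exact R.comm _ _ (by unfold Far; omega)
  | succ j ih =>
    rw [zigzag, R.lcomm (by unfold Far; omega), R.lcomm (j := j + 3) (by unfold Far; omega),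
      ih (by omega) (by omega), lie_zero, lie_zero]

theorem zigzag_one (R : SandwichD p x) {j : ℕ} (hj : j ≤ p) : ⁅x 1, zigzag x j⁆ = 0 := by
  have hp := R.three_le
  induction j with
  | zero => exact lie_self _
  | succ j ih =>
    match j, ih with
    | 0, _ =>
      rw [zigzag, zigzag, ← lie_skew (x (0 + 3)) (x 1), lie_neg, lie_neg, R.sand, neg_zero]
    | 1, _ =>
      simp only [zigzag, Nat.reduceAdd]
      rw [R.lcomm (i := 4) (j := 2) (by unfold Far; omega), ← lie_skew (x 3) (x 1)]
      simp only [lie_neg]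
      rw [R.lcomm (i := 4) (j := 1) (by unfold Far; omega), R.swap, ← lie_skew (x 4) (x 3)]
      simp only [lie_neg]
      rw [R.sand, lie_zero, lie_zero, neg_zero, neg_zero]
    -- From here on the two new letters are at least 4, hence not joined to 1.
    | j + 2, ih =>
      rw [zigzag, R.lcomm (by unfold Far; omega), R.lcomm (j := j + 2 + 3) (by unfold Far; omega),
        ih (by omega), lie_zero, lie_zero]

theorem zigzag_kill (R : SandwichD p x) {i j : ℕ} (hj : j ≤ p) (h2 : 2 ≤ i) (hi : i ≤ j + 2)
    (h0 : 1 ≤ j) : ⁅x i, zigzag x j⁆ = 0 := by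
  induction j with
  | zero => omega
  | succ j ih =>
    have e : i = j + 3 ∨ i = j + 2 ∨ i = j + 1 ∨ i ≤ j := by omega
    rcases e with rfl | rfl | rfl | h
    · exact R.sand _ _ _
    · exact R.sq _ _
    · obtain ⟨j, rfl⟩ : ∃ j', j = j' + 1 := ⟨j - 1, by omega⟩
      simp only [zigzag]
      -- If j + 2 = p, the letter j + 4 is p + 2, which is joined to p. Exchanging the two letters
      -- between the copies of x_p then creates a sandwich of x_{p+1}.
      by_cases hp : j + 2 = p
      · rw [R.swap (j + 2), R.sand, lie_zero, lie_zero]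
      · rw [R.lcomm (i := j + 1 + 3) (by unfold Far; omega), R.sand]
    · rw [zigzag, R.lcomm (by unfold Far; omega), R.lcomm (j := j + 3) (by unfold Far; omega),
        ih (by omega) (by omega) (by omega), lie_zero, lie_zero]

/-! ### The action of the generators on descending chains -/

theorem chain_start (R : SandwichD p x) {m k : ℕ} (hm : 1 ≤ m) (hk : m ≤ k) (hkp : k ≤ p + 2) :
    ⁅x m, act x (down k (m + 1)) (x m)⁆ = 0 := by
  have hp := R.three_le
  rcases hk.eq_or_lt with rfl | hk
  · rw [act_down_nil x (by omega), lie_self]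
  rw [act_down_concat x (by omega), ← lie_skew (x (m + 1)), act_neg, lie_neg, neg_eq_zero]
  by_cases h1 : m = 1 ∧ 3 ≤ k
  · obtain ⟨rfl, h3⟩ := h1
    rw [act_down_concat x (by omega), R.down_comm (by unfold Far; omega), R.sand, act_zero]
  by_cases h2 : m = p ∧ k = p + 2
  · obtain ⟨rfl, rfl⟩ := h2
    rw [_root_.down_self, act_cons, act_nil, R.sand]
  · rw [R.down_comm (by unfold Far; omega), R.sq, act_zero]

theorem chain_pred (R : SandwichD p x) {m k : ℕ} (hm : 2 ≤ m) (hk : m + 1 ≤ k) (hkp : k ≤ p + 2)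
    (h : ¬(m = p ∧ k = p + 2)) :
    ⁅x m, act x (down k (m + 2)) (x (m + 1))⁆ = -act x (down k (m + 1)) (x m) := by
  rw [R.down_comm (by unfold Far; omega), ← lie_skew (x m), act_neg,
    act_down_concat x (m := m + 1) (by omega)]

/-- Jacobi on the triangle {1, 2, 3}: x_1x_3x_2 = -x_3x_2x_1 + x_2x_3x_1. The last term is how
zigzags arise from chains. -/
theorem chain_one_two (R : SandwichD p x) {k : ℕ} (hk : 3 ≤ k) (hkp : k ≤ p + 2) :
    ⁅x 1, act x (down k 3) (x 2)⁆ = -act x (down k 2) (x 1) + act x (down k 4) (zigzag x 1) := by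
  have hp := R.three_le
  rw [act_down_concat x hk, R.down_comm (by unfold Far; omega), act_down_concat x (m := 2)
    (by omega), act_down_concat x hk, ← act_neg, ← act_add]
  congr 1
  simp only [zigzag, Nat.reduceAdd]
  rw [leibniz_lie (x 1) (x 3), ← lie_skew (x 1) (x 2), lie_neg, ← lie_skew ⁅x 1, x 3⁆,
    ← lie_skew (x 1) (x 3), lie_neg, neg_neg, add_comm]

theorem chain_one_three (R : SandwichD p x) {k : ℕ} (hk : 3 ≤ k) (hkp : k ≤ p + 2) :
    ⁅x 1, act x (down k 4) (x 3)⁆ = -act x (down k 3) (zigzag x 0) := by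
  have hp := R.three_le
  rw [R.down_comm (by unfold Far; omega), ← lie_skew (x 1), act_neg, act_down_concat x hk]
  rfl

theorem chain_far (R : SandwichD p x) {i m k : ℕ} (h : ∀ s, m ≤ s → s ≤ k → Far p i s)
    (hk : m ≤ k) : ⁅x i, act x (down k (m + 1)) (x m)⁆ = 0 := by
  rw [R.down_comm fun s hs => h s (by omega), R.comm i m (h m le_rfl hk), act_zero]

theorem zigzag_chain_start (R : SandwichD p x) {j k : ℕ} (hk : j + 3 ≤ k) (hkp : k ≤ p + 2)
    (h : ¬(j + 2 = p ∧ k = p + 2)) :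
    ⁅x (j + 2), act x (down k (j + 3)) (zigzag x j)⁆ =
      act x (down k (j + 4)) (zigzag x (j + 1)) := by
  rw [act_down_concat x hk, R.down_comm (by unfold Far; omega)]
  rfl

theorem zigzag_chain_low (R : SandwichD p x) {i j k : ℕ} (hi : 1 ≤ i) (hij : i ≤ j + 1)
    (hk : j + 2 ≤ k) (hkp : k ≤ p + 2) : ⁅x i, act x (down k (j + 3)) (zigzag x j)⁆ = 0 := by
  have hp := R.three_le
  by_cases hc : i = p ∧ k = p + 2 ∧ j + 1 = p
  · obtain ⟨rfl, rfl, rfl⟩ := hc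
    obtain ⟨j, rfl⟩ : ∃ j', j = j' + 1 := ⟨j - 1, by omega⟩
    rw [_root_.down_self, act_cons, act_nil]
    exact R.sand _ _ _
  rcases Nat.eq_zero_or_pos j with rfl | hj
  · obtain rfl : i = 1 := by omega
    rcases hk.eq_or_lt with rfl | hk
    · rw [act_down_nil x (by omega)]
      exact lie_self _
    · rw [act_down_concat x hk, R.down_comm (by unfold Far; omega), zigzag,
        ← lie_skew (x (0 + 3)) (x 1), lie_neg, R.sq, neg_zero, act_zero]
  · rw [R.down_comm (by unfold Far; omega)]
    rcases hi.eq_or_lt with rfl | hi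
    · rw [R.zigzag_one (by omega), act_zero]
    · rw [R.zigzag_kill (by omega) hi (by omega) hj, act_zero]

end SandwichD

/-- `S` contains the values of the monomials of type `D` on `p + 2` vertices, except for some of
those that start with the letter `p + 2` without passing through `p + 1` first. -/
structure ContainsD (p : ℕ) (x : ℕ → G) (S : AddSubgroup G) : Prop where
  chain : ∀ m k, 1 ≤ m → m ≤ k → k ≤ p + 2 → act x (down k (m + 1)) (x m) ∈ S
  zchain : ∀ j k, j + 2 ≤ k → k ≤ p + 2 → act x (down k (j + 3)) (zigzag x j) ∈ S
  turn : ∀ m k, 1 ≤ m → m < k → k ≤ p →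
    act x (up k p) (act x (down (p + 2) (m + 1)) (x m)) ∈ S
  zturn : ∀ j k, j + 2 ≤ k → k ≤ p →
    act x (up k p) (act x (down (p + 2) (j + 3)) (zigzag x j)) ∈ S
  one_one : ⁅x 1, act x (up 3 p) (act x (down (p + 2) 2) (x 1))⁆ ∈ S
  one_two : ⁅x 1, act x (up 3 p) (act x (down (p + 2) 3) (x 2))⁆ ∈ S
  side : ∀ m, 1 ≤ m → m ≤ p → ⁅x (p + 2), act x (down p (m + 1)) (x m)⁆ ∈ S
  zside : ∀ j, j + 2 ≤ p → ⁅x (p + 2), act x (down p (j + 3)) (zigzag x j)⁆ ∈ S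
  side_start : ⁅x (p + 1), ⁅x (p + 2), x p⁆⁆ ∈ S

/-! ### Stability under the generators: chains, zigzag chains and turns -/

namespace SandwichD

variable {p : ℕ} {x : ℕ → G} {S : AddSubgroup G}

/-- The cases follow the position of i relative to the interval from m to k. Immediately above, the
chain is prolonged; inside, the result vanishes; immediately below, a bracket is reversed. The extra
edges {1, 3} and {p, p + 2} account for the exceptional branches. -/
theorem lie_chain_mem (R : SandwichD p x) (C : ContainsD p x S) {i m k : ℕ} (hi : 1 ≤ i)
    (hip : i ≤ p + 2) (hm : 1 ≤ m) (hmk : m ≤ k) (hk : k ≤ p + 2) :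
    ⁅x i, act x (down k (m + 1)) (x m)⁆ ∈ S := by
  have hp := R.three_le
  have zero {v : G} (h : v = 0) : v ∈ S := h ▸ S.zero_mem
  rcases lt_or_ge k i with h | h
  · rcases (show k + 1 ≤ i from h).eq_or_lt with rfl | h'
    · rw [← act_down_succ x (by omega)]
      exact C.chain _ _ hm (by omega) hip
    by_cases h1 : k = 1 ∧ i = 3
    · obtain ⟨rfl, rfl⟩ := h1
      obtain rfl : m = 1 := by omega
      simpa [down, up, zigzag] using C.zchain 0 3 (by omega) (by omega)
    by_cases h2 : k = p ∧ i = p + 2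
    · obtain ⟨rfl, rfl⟩ := h2
      exact C.side m hm hmk
    · exact zero (R.chain_far (by unfold Far; omega) hmk)
  rcases lt_or_ge m i with h' | h'
  · rcases h.eq_or_lt with rfl | h
    · exact zero (R.down_self (by omega) h' _)
    by_cases h2 : i = p ∧ k = p + 2
    · obtain ⟨rfl, rfl⟩ := h2
      simpa [up] using C.turn m i hm h' le_rfl
    · exact zero (R.down_kill (by omega) (by omega) (by omega) hk h2 _)
  rcases h'.eq_or_lt with rfl | h'
  · exact zero (R.chain_start hm hmk hk)
  rcases (show i + 1 ≤ m from h').eq_or_lt with rfl | h'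
  · by_cases h1 : i = 1
    · subst h1
      rcases hmk.eq_or_lt with rfl | hmk
      · rw [act_down_nil x (by omega), ← lie_skew]
        simpa [down, up] using S.neg_mem (C.chain 1 2 le_rfl (by omega) (by omega))
      · rw [R.chain_one_two hmk hk]
        exact S.add_mem (S.neg_mem (C.chain 1 k le_rfl (by omega) hk)) (C.zchain 1 k hmk hk)
    by_cases h2 : i = p ∧ k = p + 2
    · obtain ⟨rfl, rfl⟩ := h2
      have h3 := C.chain i (i + 2) hi (by omega) le_rfl
      rw [act_down_succ x (by omega), act_down_succ x (by omega), act_down_nil x (by omega)] at h3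
      -- Jacobi on the triangle {p, p + 1, p + 2}, with i = p.
      have e : ⁅x i, ⁅x (i + 2), x (i + 1)⁆⁆ =
          ⁅x (i + 1), ⁅x (i + 2), x i⁆⁆ - ⁅x (i + 2), ⁅x (i + 1), x i⁆⁆ := by
        rw [leibniz_lie, ← lie_skew ⁅x i, x (i + 2)⁆, ← lie_skew (x i) (x (i + 2)),
          ← lie_skew (x i) (x (i + 1))]
        simp only [lie_neg, neg_neg, sub_eq_add_neg]
      rw [act_down_succ x (by omega), act_down_nil x (by omega)]
      exact e ▸ S.sub_mem C.side_start h3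
    · rw [R.chain_pred (by omega) hmk hk h2]
      exact S.neg_mem (C.chain _ _ hi (by omega) hk)
  by_cases h1 : i = 1 ∧ m = 3
  · obtain ⟨rfl, rfl⟩ := h1
    rw [R.chain_one_three hmk hk]
    exact S.neg_mem (C.zchain 0 k (by omega) hk)
  by_cases h2 : i = p ∧ m = p + 2
  · obtain ⟨rfl, rfl⟩ := h2
    obtain rfl : k = i + 2 := by omega
    rw [act_down_nil x (by omega), ← lie_skew]
    simpa [down, up] using S.neg_mem (C.side i hi le_rfl)
  · exact zero (R.chain_far (by unfold Far; omega) hmk)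

theorem lie_zchain_mem (R : SandwichD p x) (C : ContainsD p x S) {i j k : ℕ} (hi : 1 ≤ i)
    (hip : i ≤ p + 2) (hmk : j + 2 ≤ k) (hk : k ≤ p + 2) :
    ⁅x i, act x (down k (j + 3)) (zigzag x j)⁆ ∈ S := by
  have hp := R.three_le
  have zero {v : G} (h : v = 0) : v ∈ S := h ▸ S.zero_mem
  rcases lt_or_ge k i with h | h
  · rcases (show k + 1 ≤ i from h).eq_or_lt with rfl | h'
    · rw [← act_down_succ x (by omega)]
      exact C.zchain _ _ (by omega) hip
    by_cases h2 : k = p ∧ i = p + 2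
    · obtain ⟨rfl, rfl⟩ := h2
      exact C.zside j hmk
    · refine zero ?_
      rw [R.down_comm (by unfold Far; omega), R.zigzag_far (by omega) (by omega) hip, act_zero]
  rcases lt_or_ge (j + 2) i with h' | h'
  · rcases h.eq_or_lt with rfl | h
    · exact zero (R.down_self (by omega) h' _)
    by_cases h2 : i = p ∧ k = p + 2
    · obtain ⟨rfl, rfl⟩ := h2
      simpa [up] using C.zturn j i (by omega) le_rfl
    · exact zero (R.down_kill (by omega) (by omega) (by omega) hk h2 _)
  rcases h'.eq_or_lt with rfl | h'
  · rcases hmk.eq_or_lt with rfl | hmk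
    · rw [act_down_nil x (by omega)]
      rcases Nat.eq_zero_or_pos j with rfl | hj
      · simpa [down, up, zigzag] using C.chain 1 2 le_rfl (by omega) hk
      · exact zero (R.zigzag_kill (by omega) (by omega) le_rfl hj)
    by_cases h2 : j + 2 = p ∧ k = p + 2
    · obtain ⟨rfl, rfl⟩ := h2
      simpa [up] using C.zturn j (j + 2) (by omega) le_rfl
    · rw [R.zigzag_chain_start hmk hk h2]
      exact C.zchain _ _ hmk hk
  · exact zero (R.zigzag_chain_low hi (by omega) hmk hk)

/-- The generators below the turn act on the part after the turn. -/
theorem up_low (R : SandwichD p x) {i k : ℕ} (h : i + 2 ≤ k) (h' : ¬(i = 1 ∧ k = 3)) (v : G) :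
    ⁅x i, act x (up k p) v⁆ = act x (up k p) ⁅x i, v⁆ :=
  R.up_comm (by unfold Far; omega) v

theorem up_high (R : SandwichD p x) {k : ℕ} (hk : k ≤ p) (h2 : 2 ≤ k) (v : G) :
    ⁅x (p + 2), act x (up k p) (act x (down (p + 2) (p + 1)) v)⁆ = 0 := by
  obtain ⟨p, rfl⟩ : ∃ p', p = p' + 1 := ⟨p - 1, by omega⟩
  rw [act_up_split x (s := p) (by omega) (by omega), R.up_comm (by unfold Far; omega),
    _root_.up_self, act_cons, act_nil, act_down_succ x (by omega), R.sand, act_zero]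

/-- After x_{p+1} has moved inwards, the word reads x_{p+1} x_p x_{p+2} x_{p+1} x_p. Exchanging the
letters between the two x_p produces x_{p+1} x_p x_{p+1}. -/
theorem up_high' (R : SandwichD p x) {k : ℕ} (hk : k ≤ p) (h2 : 2 ≤ k) (v : G) :
    ⁅x (p + 1), act x (up k p) (act x (down (p + 2) p) v)⁆ = 0 := by
  obtain ⟨p, rfl⟩ : ∃ p', p = p' + 1 := ⟨p - 1, by omega⟩
  rw [act_up_split x (s := p) (by omega) (by omega), R.up_comm (by unfold Far; omega),
    _root_.up_self, act_cons, act_nil, act_down_succ x (by omega), act_down_succ x (by omega),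
    _root_.down_self, act_cons, act_nil, R.swap (p + 1), R.sand, act_zero]

theorem up_down_comm (R : SandwichD p x) {i s t : ℕ} (hs : i + 2 ≤ s) (ht : i + 2 ≤ t)
    (h1 : ¬(i = 1 ∧ (s = 3 ∨ t = 3))) (hi : i < p) (v : G) :
    ⁅x i, act x (up s p) (act x (down (p + 2) t) v)⁆ =
      act x (up s p) (act x (down (p + 2) t) ⁅x i, v⁆) := by
  rw [R.up_comm (by unfold Far; omega), R.down_comm (by unfold Far; omega)]

/-- All letters after the leading x_{i+1} are at least i + 2, so the inner x_i can be pulled out to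
form x_i x_{i+1} x_i. -/
theorem turn_sand (R : SandwichD p x) {i : ℕ} (hi : 2 ≤ i) (hp : i < p) (v : G) :
    ⁅x i, act x (up (i + 1) p) (act x (down (p + 2) (i + 2)) ⁅x i, v⁆)⁆ = 0 := by
  rw [act_up_cons x hp, ← R.up_down_comm (by omega) (by omega) (by omega) hp, R.sand]

theorem turn_sand_one (R : SandwichD p x) (v : G) :
    ⁅x 1, act x (up 3 p) (act x (down (p + 2) 4) ⁅x 1, v⁆)⁆ = 0 := by
  have hp := R.three_le
  rw [act_up_cons x hp, ← R.up_down_comm (by omega) (by omega) (by omega) (by omega), R.sand]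

theorem jacobi_triangle (x : ℕ → G) :
    ⁅x 3, ⁅x 2, x 1⁆⁆ = ⁅x 2, ⁅x 3, x 1⁆⁆ - ⁅x 1, ⁅x 3, x 2⁆⁆ := by
  rw [leibniz_lie, ← lie_skew ⁅x 3, x 2⁆, neg_add_eq_sub]

theorem turn_start (R : SandwichD p x) {m : ℕ} (hm : 2 ≤ m) (hp : m < p) :
    ⁅x m, act x (up (m + 1) p) (act x (down (p + 2) (m + 1)) (x m))⁆ = 0 := by
  rw [act_down_concat x (by omega), ← lie_skew (x (m + 1))]
  simp only [act_neg, lie_neg]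
  rw [R.turn_sand hm hp, neg_zero]

theorem turn_start_one (R : SandwichD p x) :
    ⁅x 1, act x (up 2 p) (act x (down (p + 2) 2) (x 1))⁆ = 0 := by
  have hp := R.three_le
  rw [act_up_cons x (by omega), act_down_concat x (by omega), act_down_concat x (by omega),
    jacobi_triangle, act_sub, act_sub, lie_sub, lie_sub, R.turn_sand le_rfl hp, lie_zero, zero_sub,
    act_up_cons x hp, ← R.up_down_comm (by omega) (by omega) (by omega) (by omega), R.swap,
    ← lie_skew (x 3) (x 2)]
  simp only [act_neg, lie_neg]
  rw [← R.up_down_comm (i := 2) (by omega) (by omega) (by omega) (by omega), R.sand]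
  simp

theorem zturn_zero (R : SandwichD p x) :
    ⁅x 1, act x (up 3 p) (act x (down (p + 2) 3) (zigzag x 0))⁆ = 0 := by
  have hp := R.three_le
  rw [act_down_concat x (by omega), zigzag, ← lie_skew (x 3)]
  simp only [act_neg, lie_neg]
  rw [R.turn_sand_one, neg_zero]

/-- The two sides differ by the third term of `jacobi_triangle`, which dies by `turn_sand_one`. With
`zturn_one'`, three brackets by x_1 collapse to the single word y^11. -/
theorem zturn_one (R : SandwichD p x) :
    ⁅x 1, act x (up 3 p) (act x (down (p + 2) 4) (zigzag x 1))⁆ =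
      ⁅x 1, act x (up 3 p) (act x (down (p + 2) 2) (x 1))⁆ := by
  have hp := R.three_le
  rw [act_down_concat x (m := 2) (by omega), act_down_concat x (m := 2 + 1) (by omega),
    jacobi_triangle, act_sub, act_sub, lie_sub, R.turn_sand_one, sub_zero]
  rfl

theorem zturn_one' (R : SandwichD p x) :
    ⁅x 1, act x (up 2 p) (act x (down (p + 2) 3) (zigzag x 0))⁆ =
      ⁅x 1, act x (up 3 p) (act x (down (p + 2) 4) (zigzag x 1))⁆ := by
  have hp := R.three_le
  rw [act_down_concat x (by omega), act_up_cons x (by omega), act_up_cons x hp]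
  simp only [zigzag, Nat.reduceAdd]
  rw [← lie_skew (x 3) (x 1)]
  simp only [act_neg, lie_neg]
  rw [← R.up_down_comm (i := 1) (by omega) (by omega) (by omega) (by omega), R.swap,
    R.up_down_comm (i := 1) (by omega) (by omega) (by omega) (by omega),
    R.up_down_comm (i := 2) (by omega) (by omega) (by omega) (by omega), act_up_cons x hp]

theorem turn_high (R : SandwichD p x) {i k t : ℕ} (hk : k ≤ p) (h2 : 2 ≤ k) (ht : t ≤ p)
    (hi : k < i) (hip : i ≤ p + 2) (v : G) :
    ⁅x i, act x (up k p) (act x (down (p + 2) t) v)⁆ = 0 := by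
  by_cases h1 : i = p + 2
  · subst h1
    rw [act_down_split x (s := p) (by omega) (by omega)]
    exact R.up_high hk h2 _
  by_cases h2 : i = p + 1
  · subst h2
    obtain ⟨p, rfl⟩ : ∃ p', p = p' + 1 := ⟨p - 1, by omega⟩
    rw [act_down_split x (s := p) (by omega) (by omega)]
    exact R.up_high' hk (by omega) _
  · exact R.up_kill (by omega) hi (by omega) _

theorem lie_turn_mem (R : SandwichD p x) (C : ContainsD p x S) {i m k : ℕ} (hi : 1 ≤ i)
    (hip : i ≤ p + 2) (hm : 1 ≤ m) (hmk : m < k) (hk : k ≤ p) :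
    ⁅x i, act x (up k p) (act x (down (p + 2) (m + 1)) (x m))⁆ ∈ S := by
  have zero {v : G} (h : v = 0) : v ∈ S := h ▸ S.zero_mem
  rcases lt_or_ge k i with h | h
  · exact zero (R.turn_high hk (by omega) (by omega) h hip _)
  rcases h.eq_or_lt with rfl | h
  · exact zero (R.up_self (by omega) _)
  by_cases h13 : i = 1 ∧ k = 3
  · obtain ⟨rfl, rfl⟩ := h13
    obtain rfl | rfl : m = 1 ∨ m = 2 := by omega
    · exact C.one_one
    · exact C.one_two
  rcases (show i + 1 ≤ k from h).eq_or_lt with rfl | h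
  · rcases (show m ≤ i by omega).eq_or_lt with rfl | hmi
    · rcases hi.eq_or_lt with rfl | hi
      · exact zero R.turn_start_one
      · exact zero (R.turn_start hi (by omega))
    · rw [← act_up_cons x (by omega)]
      exact C.turn m i hm hmi (by omega)
  rw [R.up_low h h13]
  rcases lt_or_ge m i with h' | h'
  · exact zero (by rw [R.down_kill (by omega) h' (by omega) le_rfl (by omega), act_zero])
  rcases h'.eq_or_lt with rfl | h'
  · exact zero (by rw [R.chain_start hi (by omega) le_rfl, act_zero])
  rcases (show i + 1 ≤ m from h').eq_or_lt with rfl | h'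
  · rcases hi.eq_or_lt with rfl | hi
    · rw [R.chain_one_two (by omega) le_rfl, act_add, act_neg]
      exact S.add_mem (S.neg_mem (C.turn 1 k le_rfl (by omega) hk)) (C.zturn 1 k (by omega) hk)
    · rw [R.chain_pred hi (by omega) le_rfl (by omega), act_neg]
      exact S.neg_mem (C.turn i k (by omega) (by omega) hk)
  by_cases h3 : i = 1 ∧ m = 3
  · obtain ⟨rfl, rfl⟩ := h3
    rw [R.chain_one_three (by omega) le_rfl, act_neg]
    exact S.neg_mem (C.zturn 0 k (by omega) hk)
  · exact zero (by rw [R.chain_far (by unfold Far; omega) (by omega), act_zero])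

theorem lie_zturn_mem (R : SandwichD p x) (C : ContainsD p x S) {i j k : ℕ} (hi : 1 ≤ i)
    (hip : i ≤ p + 2) (hmk : j + 2 ≤ k) (hk : k ≤ p) :
    ⁅x i, act x (up k p) (act x (down (p + 2) (j + 3)) (zigzag x j))⁆ ∈ S := by
  have zero {v : G} (h : v = 0) : v ∈ S := h ▸ S.zero_mem
  rcases lt_or_ge k i with h | h
  -- Here the descending part stops at p + 1, so `turn_high`, which needs it to reach p, does not
  -- apply. The letter p + 1 then produces a longer zigzag instead of zero.
  · by_cases hj : j + 2 = p
    · subst hj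
      obtain rfl : k = j + 2 := by omega
      rcases (show j + 2 + 1 ≤ i from h).eq_or_lt with rfl | h
      · rw [_root_.up_self, act_cons, act_nil, act_down_succ x (by omega), _root_.down_self,
          act_cons, act_nil, R.swap]
        simpa [down, up, zigzag] using C.zchain (j + 2) (j + 4) le_rfl le_rfl
      · obtain rfl : i = j + 2 + 2 := by omega
        exact zero (R.up_high le_rfl (by omega) _)
    · exact zero (R.turn_high hk (by omega) (by omega) h hip _)
  rcases h.eq_or_lt with rfl | h
  · exact zero (R.up_self (by omega) _)
  by_cases h13 : i = 1 ∧ k = 3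
  · obtain ⟨rfl, rfl⟩ := h13
    obtain rfl | rfl : j = 0 ∨ j = 1 := by omega
    · exact zero R.zturn_zero
    · exact R.zturn_one ▸ C.one_one
  rcases (show i + 1 ≤ k from h).eq_or_lt with rfl | h
  · rcases (show j ≤ i - 1 by omega).eq_or_lt with h' | h'
    · rcases hi.eq_or_lt with rfl | hi
      · subst h'
        exact R.zturn_one' ▸ R.zturn_one ▸ C.one_one
      · obtain ⟨j, rfl⟩ : ∃ j', j = j' + 1 := ⟨j - 1, by omega⟩
        obtain rfl : i = j + 2 := by omega
        exact zero (R.turn_sand (by omega) (by omega) _)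
    · rw [← act_up_cons x (by omega)]
      exact C.zturn j i (by omega) (by omega)
  rw [R.up_low h h13]
  rcases lt_or_ge (j + 2) i with h' | h'
  · exact zero (by rw [R.down_kill (by omega) h' (by omega) le_rfl (by omega), act_zero])
  rcases h'.eq_or_lt with rfl | h'
  · rw [R.zigzag_chain_start (by omega) le_rfl (by omega)]
    exact C.zturn _ _ (by omega) hk
  · exact zero (by rw [R.zigzag_chain_low hi (by omega) (by omega) le_rfl, act_zero])

theorem lie_one_one (R : SandwichD p x) {i : ℕ} (hi : 1 ≤ i) (hip : i ≤ p + 2) :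
    ⁅x i, ⁅x 1, act x (up 3 p) (act x (down (p + 2) 2) (x 1))⁆⁆ = 0 := by
  have hp := R.three_le
  rcases hi.eq_or_lt with rfl | hi
  · exact R.sq _ _
  rcases (show 2 ≤ i from hi).eq_or_lt with rfl | hi
  · rw [← R.zturn_one, act_up_cons x hp]
    simp only [zigzag, Nat.reduceAdd]
    rw [← R.up_down_comm (i := 2) (by omega) (by omega) (by omega) (by omega), R.swap,
      ← lie_skew (x 3) (x 1)]
    simp only [act_neg, lie_neg]
    rw [← R.up_down_comm (i := 1) (by omega) (by omega) (by omega) (by omega), R.sand, lie_zero,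
      lie_zero, neg_zero]
  rcases (show 3 ≤ i from hi).eq_or_lt with rfl | hi
  · rw [act_up_cons x hp, R.sand]
  · rw [R.lcomm (by unfold Far; omega), R.turn_high hp (by omega) (by omega) hi hip, lie_zero]

theorem lie_one_two_mem (R : SandwichD p x) (C : ContainsD p x S) {i : ℕ} (hi : 1 ≤ i)
    (hip : i ≤ p + 2) : ⁅x i, ⁅x 1, act x (up 3 p) (act x (down (p + 2) 3) (x 2))⁆⁆ ∈ S := by
  have hp := R.three_le
  have zero {v : G} (h : v = 0) : v ∈ S := h ▸ S.zero_mem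
  rcases hi.eq_or_lt with rfl | hi
  · exact zero (R.sq _ _)
  rcases (show 2 ≤ i from hi).eq_or_lt with rfl | hi
  -- Pull the inner x_2 out, exchange x_1 and x_3 between the two copies of x_2, push x_1 and x_2
  -- back in, and apply Jacobi on {1, 2, 3}.
  · have e : ⁅x 2, ⁅x 1, act x (up 3 p) (act x (down (p + 2) 3) (x 2))⁆⁆ =
        -act x (up 2 p) (act x (down (p + 2) 2) (x 1)) := by
      have h := jacobi_triangle x
      rw [act_down_concat x (by omega), act_up_cons x hp, ← lie_skew (x 3) (x 2)]
      simp only [act_neg, lie_neg, Nat.reduceAdd]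
      rw [← R.up_down_comm (i := 2) (by omega) (by omega) (by omega) (by omega), R.swap,
        R.up_down_comm (i := 2) (by omega) (by omega) (by omega) (by omega),
        R.up_down_comm (i := 1) (by omega) (by omega) (by omega) (by omega),
        ← lie_skew (x 2) (x 3), lie_neg,
        show ⁅x 1, ⁅x 3, x 2⁆⁆ = ⁅x 2, ⁅x 3, x 1⁆⁆ - ⁅x 3, ⁅x 2, x 1⁆⁆ by rw [h]; abel,
        ← act_up_cons x (i := 3) hp, act_neg, act_neg, act_sub, act_sub, lie_neg, lie_sub,
        R.turn_sand le_rfl hp]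
      rw [act_up_cons x (i := 2) (by omega), act_down_concat x (m := 2) (by omega),
        act_down_concat x (m := 3) (by omega)]
      simp
    exact e ▸ S.neg_mem (C.turn 1 2 le_rfl (by omega) (by omega))
  rcases (show 3 ≤ i from hi).eq_or_lt with rfl | hi
  · exact zero (by rw [act_up_cons x hp, R.sand])
  · rw [R.lcomm (by unfold Far; omega), R.turn_high hp (by omega) (by omega) hi hip]
    exact zero (lie_zero _)

end SandwichD

end Act

/-! ### The symmetry exchanging the two top letters -/

section Swap

variable {G : Type*} {p : ℕ}

/-- Interchange the values of the letters `p + 1` and `p + 2`. -/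
def swapTop (p : ℕ) (x : ℕ → G) (i : ℕ) : G :=
  if i = p + 1 then x (p + 2) else if i = p + 2 then x (p + 1) else x i

theorem swapTop_first (p : ℕ) (x : ℕ → G) : swapTop p x (p + 1) = x (p + 2) := by simp [swapTop]

theorem swapTop_second (p : ℕ) (x : ℕ → G) : swapTop p x (p + 2) = x (p + 1) := by simp [swapTop]

theorem swapTop_of_le {i : ℕ} (h : i ≤ p) (x : ℕ → G) : swapTop p x i = x i := by
  rw [swapTop, if_neg (by omega), if_neg (by omega)]

end Swap

/-! ### The relation between the two orders of the top letters above a zigzag -/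

section Hard

variable {G : Type*} [LieRing G] {p : ℕ} {x : ℕ → G} {S : AddSubgroup G}

/-- The value of the word
`x_{p - j + 1}x_{p - j} ⋯ x_{p - 1}x_{p - 2} x_px_{p - 1} x_{p + 2}x_px_{p + 1}`. -/
def tower (p : ℕ) (x : ℕ → G) : ℕ → G
  | 0 => ⁅x (p + 2), ⁅x p, x (p + 1)⁆⁆
  | j + 1 => ⁅x (p - j), ⁅x (p - 1 - j), tower p x j⁆⁆

namespace SandwichD

/-- Since v is killed by all letters above t, only one term of each expanded commutator survives.
The outer letters of the tower become the ascending part and the inner ones the descending part;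
each level contributes one sign. -/
theorem tower_lie (R : SandwichD p x) (j t : ℕ) (ht : 2 ≤ t) (hj : t + j = p) (v : G)
    (hv : ∀ s, t < s → s ≤ p + 2 → ⁅x s, v⁆ = 0) :
    ⁅tower p x j, v⁆ =
      (-1 : ℤ) ^ (j + 1) • act x (up (t + 1) p) (act x (down (p + 2) t) v) := by
  induction j generalizing t v with
  | zero =>
    obtain rfl : t = p := hj
    rw [act_up_nil x (by omega), act_down_succ x (by omega), act_down_succ x (by omega),
      _root_.down_self, act_cons, act_nil, tower, lie_lie (x (t + 2)),
      hv (t + 2) (by omega) le_rfl, lie_lie, hv (t + 1) (by omega) (by omega)]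
    simp only [lie_zero, sub_zero, zero_sub, lie_neg, zero_add, pow_one, neg_smul, one_smul]
  | succ j ih =>
    rw [tower, show p - j = t + 1 by omega, show p - 1 - j = t by omega, lie_lie, lie_lie,
      hv (t + 1) (by omega) (by omega), lie_zero, sub_zero,
      ih (t + 1) (by omega) (by omega) v (fun s h h' => hv s (by omega) h'),
      act_down_concat x (m := t + 1) (by omega), hv (t + 1) (by omega) (by omega),
      act_zero, act_zero, smul_zero, lie_zero, zero_sub,
      ih (t + 1) (by omega) (by omega) ⁅x t, v⁆ fun s h h' => by
        rw [R.lcomm (by unfold Far; omega), hv s (by omega) h', lie_zero],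
      lie_neg, lie_zsmul, pow_succ _ (j + 1), act_up_cons x (i := t + 1) (by omega),
      act_down_concat x (m := t) (by omega)]
    simp

theorem lie_tower (R : SandwichD p x) (j t : ℕ) (hj : t + j = p) :
    ⁅x t, tower p x j⁆ = 0 := by
  cases j with
  | zero =>
    obtain rfl : t = p := hj
    exact R.sand _ _ _
  | succ j =>
    rw [tower, show p - j = t + 1 by omega, show p - 1 - j = t by omega, R.sand]

/-- Modulo S, the outer two letters of the zigzag can be transferred to the tower, with r + j fixed.
At r = 0 only x_1 is left of the zigzag, and `tower_lie` applied to x_2 evaluates the bracket. -/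
theorem tower_zigzag (R : SandwichD p x)
    (hz : ∀ j k, j + 2 ≤ k → k ≤ p →
      act x (up k p) (act x (down (p + 2) (j + 3)) (zigzag x j)) ∈ S)
    (h1 : act x (up 3 p) (act x (down (p + 2) 2) (x 1)) ∈ S) (r j : ℕ) (hj : r + j + 2 = p) :
    ⁅tower p x j, zigzag x r⁆ -
      (-1 : ℤ) ^ p • ⁅x 1, act x (up 3 p) (act x (down (p + 2) 3) (x 2))⁆ ∈ S := by
  have hp := R.three_le
  induction r generalizing j with
  | zero =>
    obtain ⟨j, rfl⟩ : ∃ j', j = j' + 1 := ⟨j - 1, by omega⟩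
    have e := R.tower_lie j 3 (by omega) (by omega) (x 2) fun s h h' =>
      R.comm _ _ (by unfold Far; omega)
    rw [zigzag, tower, show p - j = 3 by omega, show p - 1 - j = 2 by omega, ← lie_skew ⁅x 3, _⁆ (x 1),
      ← lie_skew (x 2) (tower p x j), e, show (-1 : ℤ) ^ p = (-1) ^ (j + 1) by
        rw [show p = j + 1 + 2 by omega, pow_add _ (j + 1)]; simp, act_up_cons x (i := 3) (by omega)]
    simp
  | succ r ih =>
    have hd := ih (j + 1) (by omega)
    have e := R.tower_lie j (r + 3) (by omega) (by omega) (zigzag x r) fun s h h' =>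
      R.zigzag_far (by omega) (by omega) h'
    have h2 := R.lie_tower j (r + 3) (by omega)
    -- The error terms `a1`, `a2`, `a3` of the transfer are turning words, up to sign, or zero. The
    -- exception r = 0 in `a3` is the reason for the hypothesis `h1`.
    have a1 : ⁅x (r + 2), ⁅x (r + 3), ⁅tower p x j, zigzag x r⁆⁆⁆ ∈ S := by
      rw [e, lie_zsmul, lie_zsmul, ← act_up_cons x (by omega), ← act_up_cons x (by omega)]
      exact S.zsmul_mem (hz _ _ le_rfl (by omega)) _
    have a2 : ⁅x (r + 3), ⁅x (r + 2), ⁅tower p x j, zigzag x r⁆⁆⁆ ∈ S := by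
      rw [e, lie_zsmul, lie_zsmul, act_down_concat x (by omega),
        R.up_down_comm (by omega) (by omega) (by omega) (by omega), ← act_up_cons x (by omega)]
      exact S.zsmul_mem (hz (r + 1) (r + 3) le_rfl (by omega)) _
    have a3 : ⁅x (r + 3), ⁅tower p x j, ⁅x (r + 2), zigzag x r⁆⁆⁆ ∈ S := by
      rcases Nat.eq_zero_or_pos r with rfl | hr
      · have e := R.tower_lie j 3 (by omega) (by omega) ⁅x 2, x 1⁆ fun s h h' => by
          rw [R.lcomm (by unfold Far; omega), R.comm s 1 (by unfold Far; omega), lie_zero]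
        simp only [zigzag, zero_add]
        rw [e, lie_zsmul, ← act_up_cons x (by omega)]
        rw [act_down_concat x (by omega)] at h1
        exact S.zsmul_mem h1 _
      · rw [R.zigzag_kill (by omega) (by omega) le_rfl hr]
        simp [S.zero_mem]
    rw [tower, show p - j = r + 3 by omega, show p - 1 - j = r + 2 by omega] at hd
    have e2 : ⁅tower p x j, zigzag x (r + 1)⁆ =
        ⁅x (r + 2), ⁅x (r + 3), ⁅tower p x j, zigzag x r⁆⁆⁆ -
        (⁅x (r + 3), ⁅x (r + 2), ⁅tower p x j, zigzag x r⁆⁆⁆ -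
        ⁅x (r + 3), ⁅tower p x j, ⁅x (r + 2), zigzag x r⁆⁆⁆) +
        ⁅⁅x (r + 3), ⁅x (r + 2), tower p x j⁆⁆, zigzag x r⁆ := by
      have b1 : ⁅x (r + 3), ⁅tower p x j, zigzag x r⁆⁆ =
          ⁅tower p x j, ⁅x (r + 3), zigzag x r⁆⁆ := by
        rw [leibniz_lie, h2, zero_lie, zero_add]
      rw [zigzag, b1, lie_lie (x (r + 3)), lie_lie (x (r + 2)) _ (zigzag x r), lie_sub,
        lie_lie (x (r + 2))]
      abel
    rw [e2, add_sub_assoc]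
    exact S.add_mem (S.sub_mem a1 (S.sub_mem a2 a3)) hd

/-- The relation that brings `x_p x_{p + 1} x_{p + 2}` followed by a zigzag into normal form. -/
theorem hard_relation (R : SandwichD p x)
    (hz : ∀ j k, j + 2 ≤ k → k ≤ p →
      act x (up k p) (act x (down (p + 2) (j + 3)) (zigzag x j)) ∈ S)
    (h1 : act x (up 3 p) (act x (down (p + 2) 2) (x 1)) ∈ S)
    (h2 : ⁅x (p + 2), ⁅x p, ⁅x (p + 1), zigzag x (p - 2)⁆⁆⁆ ∈ S)
    (h3 : ⁅x (p + 1), ⁅x p, ⁅x (p + 2), zigzag x (p - 2)⁆⁆⁆ ∈ S) :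
    ⁅x p, ⁅x (p + 1), ⁅x (p + 2), zigzag x (p - 2)⁆⁆⁆ +
      (-1 : ℤ) ^ p • ⁅x 1, act x (up 3 p) (act x (down (p + 2) 3) (x 2))⁆ ∈ S := by
  have hp := R.three_le
  -- Expanding ⁅x_{p+2}, ⁅x_p, x_{p+1}⁆⁆ on the zigzag gives four terms: one vanishes since x_p
  -- kills the zigzag, two are `h2` and `h3`, and the last is the word sought.
  have h := R.tower_zigzag hz h1 (p - 2) 0 (by omega)
  have e := R.zigzag_kill (i := p) (j := p - 2) (by omega) (by omega) (by omega) (by omega)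
  rw [tower, lie_lie, lie_lie, lie_lie, e, lie_zero, sub_zero] at h
  have := S.sub_mem (S.add_mem h2 h3) h
  convert this using 1
  abel

end SandwichD

theorem act_up_swapTop {k j : ℕ} (h : j ≤ p) (v : G) :
    act (swapTop p x) (up k j) v = act x (up k j) v :=
  act_congr (fun i hi => swapTop_of_le (by have := mem_up.1 hi; omega) x) v

theorem act_down_swapTop {k j : ℕ} (h : j ≤ p) (v : G) :
    act (swapTop p x) (down j k) v = act x (down j k) v :=
  act_congr (fun i hi => swapTop_of_le (by have := mem_down.1 hi; omega) x) v

theorem zigzag_swapTop {j : ℕ} (h : j + 2 ≤ p) : zigzag (swapTop p x) j = zigzag x j := by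
  induction j with
  | zero => exact swapTop_of_le (by omega) x
  | succ j ih =>
    rw [zigzag, zigzag, ih (by omega), swapTop_of_le (by omega), swapTop_of_le (by omega)]

theorem zigzag_swapTop_pred (hp : 3 ≤ p) :
    zigzag (swapTop p x) (p - 1) = ⁅x p, ⁅x (p + 2), zigzag x (p - 2)⁆⁆ := by
  obtain ⟨p, rfl⟩ : ∃ p', p = p' + 2 := ⟨p - 2, by omega⟩
  have e : swapTop (p + 2) x (p + 3) = x (p + 4) := swapTop_first _ _
  rw [show p + 2 - 1 = p + 1 by omega, zigzag, zigzag_swapTop (by omega), swapTop_of_le le_rfl, e]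
  rfl

theorem zigzag_swapTop_self (hp : 3 ≤ p) :
    zigzag (swapTop p x) p =
      ⁅x (p + 2), ⁅x (p + 1), ⁅x p, ⁅x (p + 2), zigzag x (p - 2)⁆⁆⁆⁆ := by
  rw [← zigzag_swapTop_pred hp]
  obtain ⟨p, rfl⟩ : ∃ p', p = p' + 1 := ⟨p - 1, by omega⟩
  have e : swapTop (p + 1) x (p + 3) = x (p + 2) := swapTop_second _ _
  rw [zigzag, swapTop_first, e]
  rfl

namespace SandwichD

theorem swapTop (R : SandwichD p x) : SandwichD p (swapTop p x) where
  three_le := R.three_le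
  comm i j h := by
    have hp := R.three_le
    unfold _root_.swapTop
    split_ifs with h1 h2 h3 h4 h5 h6 <;> first
      | exact lie_self _
      | exact R.comm _ _ (by unfold Far at *; omega)
  sq i v := by unfold _root_.swapTop; split_ifs <;> exact R.sq _ _
  sand i u v := by unfold _root_.swapTop; split_ifs <;> exact R.sand _ _ _

/-- At the turn the word reads x_p x_{p+2} x_{p+1} x_p, where the two middle letters may be
exchanged by `SandwichD.swap`. The condition t ≤ p supplies the second x_p. -/
theorem turn_swapTop (R : SandwichD p x) {k t : ℕ} (hk : k ≤ p) (ht : t ≤ p) (v : G) :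
    act (_root_.swapTop p x) (up k p) (act (_root_.swapTop p x) (down (p + 2) t) v) =
      act x (up k p) (act x (down (p + 2) t) v) := by
  obtain ⟨p, rfl⟩ : ∃ p', p = p' + 1 := ⟨p - 1, by have := R.three_le; omega⟩
  have e (w : G) : act x (up k (p + 1)) w = act x (up k p) ⁅x (p + 1), w⁆ := by
    rw [act_up_split x (s := p) (by omega) (by omega), _root_.up_self, act_cons, act_nil]
  rw [act_up_swapTop le_rfl, e, e, act_down_succ _ (by omega), act_down_succ _ (by omega),
    act_down_succ x (by omega), act_down_succ x (by omega), swapTop_first,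
    show p + 1 + 1 + 1 = p + 1 + 2 from rfl, swapTop_second, act_down_swapTop le_rfl,
    act_down_succ x (by omega), R.swap]

end SandwichD

end Hard

/-! ### The monomials of type `D` -/

section Words

variable {G : Type*} [LieRing G] {p : ℕ} {x : ℕ → G} {S : AddSubgroup G}

/-- `S` contains the values of all monomials of type `D` on `p + 2` vertices. -/
structure ContainsAllD (p : ℕ) (x : ℕ → G) (S : AddSubgroup G) : Prop extends ContainsD p x S where
  side' : ∀ m, 1 ≤ m → m ≤ p → ⁅x (p + 1), ⁅x (p + 2), act x (down p (m + 1)) (x m)⁆⁆ ∈ S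
  zside' : ∀ j, j + 2 ≤ p → ⁅x (p + 1), ⁅x (p + 2), act x (down p (j + 3)) (zigzag x j)⁆⁆ ∈ S
  top : ⁅x p, ⁅x (p + 2), zigzag x (p - 2)⁆⁆ ∈ S
  top' : ⁅x (p + 1), ⁅x p, ⁅x (p + 2), zigzag x (p - 2)⁆⁆⁆ ∈ S
  top'' : ⁅x (p + 2), ⁅x (p + 1), ⁅x p, ⁅x (p + 2), zigzag x (p - 2)⁆⁆⁆⁆ ∈ S

/-- The list is invariant under the symmetry up to sign, except for the turn at p above the zigzag
of index p - 2. This allows the stability lemmas to be reused for the swapped generators. -/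
theorem ContainsAllD.containsD_swapTop (R : SandwichD p x) (C : ContainsAllD p x S) :
    ContainsD p (swapTop p x) S where
  chain m k hm hmk hk := by
    rcases (show k ≤ p ∨ k = p + 1 ∨ k = p + 2 by omega) with h | rfl | rfl
    · rw [act_down_swapTop h, swapTop_of_le (by omega)]
      exact C.chain m k hm hmk hk
    · rcases hmk.eq_or_lt with rfl | hmk
      · simpa [down, up, swapTop_first] using C.chain (p + 2) (p + 2) (by omega) le_rfl le_rfl
      · rw [act_down_succ _ (by omega), act_down_swapTop le_rfl, swapTop_first,
          swapTop_of_le (by omega)]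
        exact C.side m hm (by omega)
    · rcases (show m ≤ p ∨ m = p + 1 ∨ m = p + 2 by omega) with h | rfl | rfl
      · rw [act_down_succ _ (by omega), act_down_succ _ (by omega), act_down_swapTop le_rfl,
          swapTop_first, swapTop_second, swapTop_of_le h]
        exact C.side' m hm h
      · have h := C.chain (p + 1) (p + 2) hm hmk le_rfl
        rw [_root_.down_self, act_cons, act_nil] at h
        rw [_root_.down_self, act_cons, act_nil, swapTop_second, swapTop_first, ← lie_skew]
        exact S.neg_mem h
      · simpa [down, up, swapTop_second] using C.chain (p + 1) (p + 1) (by omega) le_rfl (by omega)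
  zchain j k hj hk := by
    have hp := R.three_le
    rcases (show j + 2 ≤ p ∨ j = p - 1 ∨ j = p by omega) with h | rfl | rfl
    · rw [zigzag_swapTop h]
      rcases (show k ≤ p ∨ k = p + 1 ∨ k = p + 2 by omega) with h' | rfl | rfl
      · rw [act_down_swapTop h']
        exact C.zchain j k hj hk
      · rw [act_down_succ _ (by omega), act_down_swapTop le_rfl, swapTop_first]
        exact C.zside j h
      · rw [act_down_succ _ (by omega), act_down_succ _ (by omega), act_down_swapTop le_rfl,
          swapTop_first, swapTop_second]
        exact C.zside' j h
    · rw [zigzag_swapTop_pred hp]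
      rcases (show k = p + 1 ∨ k = p + 2 by omega) with rfl | rfl
      · rw [act_down_nil _ (by omega)]
        exact C.top
      · rw [act_down_succ _ (by omega), act_down_nil _ (by omega),
          show p + 1 + 1 = p + 2 from rfl, swapTop_second]
        exact C.top'
    · obtain rfl : k = j + 2 := by omega
      rw [act_down_nil _ (by omega), zigzag_swapTop_self hp]
      exact C.top''
  turn m k hm hmk hk := by
    rw [R.turn_swapTop hk (by omega), swapTop_of_le (by omega)]
    exact C.turn m k hm hmk hk
  zturn j k hj hk := by
    rw [zigzag_swapTop (by omega)]
    rcases (show j + 3 ≤ p ∨ j + 2 = p by omega) with h | rfl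
    · rw [R.turn_swapTop hk h]
      exact C.zturn j k hj hk
    -- The swapped word is x_p x_{p+1} x_{p+2} followed by a zigzag; it equals a multiple of y^12
    -- modulo S.
    · obtain rfl : k = j + 2 := by omega
      have h := R.hard_relation C.zturn (C.turn 1 3 le_rfl (by omega) R.three_le)
        (by simpa [down, up, zigzag] using C.zchain (j + 1) (j + 4) (by omega) le_rfl) C.top'
      have h' := S.sub_mem h (S.zsmul_mem C.one_two ((-1) ^ (j + 2)))
      rw [add_sub_cancel_right] at h'
      rw [_root_.up_self, act_cons, act_nil, act_down_succ _ (by omega), act_down_succ _ (by omega),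
        act_down_nil _ (by omega), swapTop_first, swapTop_second, swapTop_of_le le_rfl]
      exact h'
  one_one := by
    have hp := R.three_le
    rw [R.turn_swapTop hp (by omega), swapTop_of_le (by omega)]
    exact C.one_one
  one_two := by
    have hp := R.three_le
    rw [R.turn_swapTop hp (by omega), swapTop_of_le (by omega), swapTop_of_le (by omega)]
    exact C.one_two
  side m hm hmp := by
    rw [act_down_swapTop le_rfl, swapTop_second, swapTop_of_le hmp, ← act_down_succ x (by omega)]
    exact C.chain m (p + 1) hm (by omega) (by omega)
  zside j hj := by
    rw [act_down_swapTop le_rfl, swapTop_second, zigzag_swapTop hj, ← act_down_succ x (by omega)]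
    exact C.zchain j (p + 1) (by omega) (by omega)
  side_start := by
    rw [swapTop_first, swapTop_second, swapTop_of_le le_rfl]
    have h := C.chain p (p + 2) (by have := R.three_le; omega) (by omega) le_rfl
    rwa [act_down_succ x (by omega), act_down_succ x (by omega), act_down_nil x (by omega)] at h

end Words

/-! ### The number of words of type `D` -/

section Count

theorem length_up (i j : ℕ) : (up i j).length = j + 1 - i := by simp [up]

theorem length_down (i j : ℕ) : (down j i).length = j + 1 - i := by simp [down, length_up]

theorem reverse_down (i j : ℕ) : (down j i).reverse = up i j := by simp [down]

theorem headD_append {α : Type*} (u v : List α) (d : α) :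
    (u ++ v).headD d = u.headD (v.headD d) := by cases u <;> rfl

theorem headD_up (i j d : ℕ) : (up i j).headD d = if i ≤ j then i else d := by
  split_ifs with h
  · rw [up_cons h]; rfl
  · rw [up_eq_nil (by omega)]; rfl

theorem headD_down (i j d : ℕ) : (down j i).headD d = if i ≤ j then j else d := by
  split_ifs with h
  · cases j with
    | zero => obtain rfl : i = 0 := by omega
              rfl
    | succ j => rw [down_succ_cons h]; rfl
  · rw [down_eq_nil (by omega)]; rfl

/-- The word `j + 1, j + 2, j, j + 1, …, 2, 3`. -/
def zig (j : ℕ) : List ℕ := (down (j + 1) 2).flatMap fun k => [k, k + 1]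

theorem upDown_eq (j : ℕ) : upDown (j + 1) 1 = zig j ++ [1] := rfl

theorem length_zig (j : ℕ) : (zig j).length = 2 * j := by
  induction j with
  | zero => rfl
  | succ j ih => rw [zig, down_succ_cons (by omega), List.flatMap_cons, List.length_append,
      ← zig, ih]; simp; omega

theorem headD_zig (j d : ℕ) : (zig j).headD d = if j = 0 then d else j + 1 := by
  cases j with
  | zero => rfl
  | succ j => rw [zig, down_succ_cons (by omega)]; simp

theorem headD_reverse_zig (j d : ℕ) : (zig j).reverse.headD d = if j = 0 then d else 3 := by
  cases j with
  | zero => rfl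
  | succ j => rw [zig, down_concat (by omega)]; simp

theorem mem_zig {j a : ℕ} : a ∈ zig j ↔ 1 ≤ j ∧ 2 ≤ a ∧ a ≤ j + 2 := by
  simp only [zig, List.mem_flatMap, mem_down, List.mem_cons, List.not_mem_nil, or_false]
  constructor
  · rintro ⟨b, h, h'⟩; omega
  · intro h
    rcases (show a ≤ j + 1 ∨ a = j + 2 by omega) with h' | h'
    · exact ⟨a, by omega, by simp⟩
    · exact ⟨a - 1, by omega, by omega⟩

/-- Length, first letter, last two letters, and occurrences of the two largest letters. -/
def Shape (p : ℕ) (w : List ℕ) (l f e e' : ℕ) (P Q : Prop) : Prop :=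
  w.length = l ∧ w.headD 0 = f ∧ w.reverse.headD 0 = e ∧ w.reverse.tail.headD 0 = e' ∧
    (p + 2 ∈ w ↔ P) ∧ (p + 1 ∈ w ↔ Q)

/-- The words of type `D` on `p + 2` vertices, in thirteen families with two parameters. -/
def codeWord (p : ℕ) : ℕ → ℕ → ℕ → List ℕ
  | 0, k, i => down (k + 1) (i + 1)
  | 1, k, i => up (k + 2) p ++ down (p + 2) (i + 1)
  | 2, k, i => down (k + 3) (i + 3) ++ upDown (i + 1) 1
  | 3, k, i => up (k + 2) p ++ down (p + 2) (i + 3) ++ upDown (i + 1) 1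
  | 4, _, i => [p + 2] ++ down p (i + 1)
  | 5, _, i => [p + 1, p + 2] ++ down p (i + 1)
  | 6, _, i => [p + 2] ++ down p (i + 3) ++ upDown (i + 1) 1
  | 7, _, i => [p + 1, p + 2] ++ down p (i + 3) ++ upDown (i + 1) 1
  | 8, _, _ => [1] ++ up 3 p ++ down (p + 2) 1
  | 9, _, _ => [1] ++ up 3 p ++ down (p + 2) 2
  | 10, _, _ => [p, p + 2] ++ upDown (p - 1) 1
  | 11, _, _ => [p + 1, p, p + 2] ++ upDown (p - 1) 1
  | _, _, _ => [p + 2, p + 1, p, p + 2] ++ upDown (p - 1) 1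

/-- The number of values of the first parameter. -/
def codeRows (p : ℕ) : ℕ → ℕ
  | 0 => p + 2
  | 1 => p - 1
  | 2 => p
  | 3 => p - 1
  | _ => 1

/-- The number of values of the second parameter. -/
def codeRow (p : ℕ) : ℕ → ℕ → ℕ
  | 0, k => k + 1
  | 1, k => k + 1
  | 2, k => k + 2
  | 3, k => k + 1
  | 4, _ => p
  | 5, _ => p
  | 6, _ => p - 1
  | 7, _ => p - 1
  | _, _ => 1

/-- Bounds for the parameters of `codeWord`. -/
def IsCode (p c k i : ℕ) : Prop := c < 13 ∧ k < codeRows p c ∧ i < codeRow p c k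

def shapeLength (p : ℕ) : ℕ → ℕ → ℕ → ℕ
  | 0, k, i => k + 1 - i
  | 1, k, i => (p - 1 - k) + (p + 2 - i)
  | 2, k, i => (k + 1 - i) + (2 * i + 1)
  | 3, k, i => (p - 1 - k) + (p - i) + (2 * i + 1)
  | 4, _, i => p - i + 1
  | 5, _, i => p - i + 2
  | 6, _, i => p - 2 - i + 1 + (2 * i + 1)
  | 7, _, i => p - 2 - i + 2 + (2 * i + 1)
  | 8, _, _ => 2 * p + 1
  | 9, _, _ => 2 * p
  | 10, _, _ => 2 * p - 1
  | 11, _, _ => 2 * p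
  | _, _, _ => 2 * p + 1

def shapeFirst (p : ℕ) : ℕ → ℕ → ℕ → ℕ
  | 0, k, _ => k + 1
  | 1, k, _ => k + 2
  | 2, k, i => if i ≤ k then k + 3 else k + 2
  | 3, k, _ => k + 2
  | 4, _, _ => p + 2
  | 5, _, _ => p + 1
  | 6, _, _ => p + 2
  | 7, _, _ => p + 1
  | 8, _, _ => 1
  | 9, _, _ => 1
  | 10, _, _ => p
  | 11, _, _ => p + 1
  | _, _, _ => p + 2

def shapeLast : ℕ → ℕ → ℕ
  | 0, i => i + 1
  | 1, i => i + 1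
  | 4, i => i + 1
  | 5, i => i + 1
  | 9, _ => 2
  | _, _ => 1

def shapeLast' (p : ℕ) : ℕ → ℕ → ℕ → ℕ
  | 0, k, i => if i < k then i + 2 else 0
  | 1, _, i => i + 2
  | 4, _, i => if i + 1 < p then i + 2 else p + 2
  | 5, _, i => if i + 1 < p then i + 2 else p + 2
  | 8, _, _ => 2
  | _, _, _ => 3

def shapeTop (p : ℕ) : ℕ → ℕ → Prop
  | 0, k => k = p + 1
  | 2, k => k + 1 = p
  | _, _ => True

def shapeTop' (p : ℕ) : ℕ → ℕ → ℕ → Prop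
  | 0, k, i => p ≤ k ∧ i ≤ p
  | 2, k, _ => p ≤ k + 2
  | 4, _, _ => False
  | 6, _, _ => False
  | 10, _, _ => False
  | _, _, _ => True

theorem shape_codeWord {p c k i : ℕ} (hp : 3 ≤ p) (h : IsCode p c k i) :
    Shape p (codeWord p c k i) (shapeLength p c k i) (shapeFirst p c k i) (shapeLast c i)
      (shapeLast' p c k i) (shapeTop p c k) (shapeTop' p c k i) := by
  obtain ⟨hc, hk, hi⟩ := h
  have e : upDown (p - 1) 1 = zig (p - 2) ++ [1] := by
    rw [show p - 1 = p - 2 + 1 by omega, upDown_eq]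
  interval_cases c <;> simp only [codeRows, codeRow] at hk hi <;>
    simp only [codeWord, shapeLength, shapeFirst, shapeLast, shapeLast', shapeTop, shapeTop',
      Shape, upDown_eq, e]
  all_goals
    try first
      | rw [down_concat (show i + 1 ≤ k + 1 by omega)]
      | rw [down_concat (show i + 1 ≤ p + 2 by omega)]
      | rw [down_concat (show i + 1 ≤ p by omega)]
      | rw [down_concat (show 1 ≤ p + 2 by omega)]
      | rw [down_concat (show 2 ≤ p + 2 by omega)]
  all_goals
    refine ⟨?_, ?_, ?_, ?_, ?_, ?_⟩
    · simp only [List.length_append, List.length_cons, List.length_nil, length_up, length_down,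
        length_zig]
      omega
    · simp only [headD_append, headD_up, headD_down, headD_zig, List.headD_cons, List.cons_append]
      try (split_ifs <;> omega)
    · simp only [List.reverse_append, List.reverse_cons, List.reverse_nil, List.nil_append,
        List.cons_append, List.headD_cons]
    · simp only [List.reverse_append, List.reverse_cons, List.reverse_nil, List.nil_append,
        List.cons_append, List.tail_cons, reverse_down, headD_append, headD_up,
        headD_reverse_zig, List.headD_cons]
      try (split_ifs <;> omega)
    · simp only [List.mem_append, List.mem_cons, List.not_mem_nil, mem_up, mem_down, mem_zig,
        or_false, true_or, or_true, iff_true]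
      try omega
    · simp only [List.mem_append, List.mem_cons, List.not_mem_nil, mem_up, mem_down, mem_zig,
        or_false, true_or, or_true, iff_true, iff_false]
      try omega

-- The invariants recorded in `Shape` already determine the family and both parameters, so each pair
-- of families reduces to linear arithmetic.
set_option maxHeartbeats 4000000 in
theorem codeWord_injective {p c k i c' k' i' : ℕ} (hp : 3 ≤ p) (h : IsCode p c k i)
    (h' : IsCode p c' k' i') (he : codeWord p c k i = codeWord p c' k' i') :
    c = c' ∧ k = k' ∧ i = i' := by
  obtain ⟨a1, a2, a3, a4, a5, a6⟩ := shape_codeWord hp h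
  obtain ⟨b1, b2, b3, b4, b5, b6⟩ := shape_codeWord hp h'
  rw [he] at a1 a2 a3 a4 a5 a6
  replace b1 := a1.symm.trans b1
  replace b2 := a2.symm.trans b2
  replace b3 := a3.symm.trans b3
  replace b4 := a4.symm.trans b4
  replace b5 := a5.symm.trans b5
  replace b6 := a6.symm.trans b6
  clear a1 a2 a3 a4 a5 a6 he
  obtain ⟨hc, hk, hi⟩ := h
  obtain ⟨hc', hk', hi'⟩ := h'
  interval_cases c <;> interval_cases c' <;> simp only [codeRows, codeRow] at hk hi hk' hi' <;>
    simp only [shapeLength, shapeFirst, shapeLast, shapeLast', shapeTop, shapeTop', iff_true,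
      true_iff, iff_false, false_iff, not_true_eq_false] at b1 b2 b3 b4 b5 b6
  all_goals first
    | omega
    | (split_ifs at b2 b4 <;> omega)

end Count

/-! ### Enumeration of the words of types D and B -/

section Count

/-- Seventeen classes become thirteen families: since `upDown 1 1` is the one-letter word 1, the
classes y^7, y^8, y^13, y^14 are the case m = 2 of y^3, y^4, y^9, y^10. -/
theorem mem_wordsD_iff {p : ℕ} (hp : 3 ≤ p) {w : List ℕ} :
    w ∈ wordsD (p + 2) ↔ ∃ c k i, IsCode p c k i ∧ w = codeWord p c k i := by
  have hn : p + 2 - 2 = p := by omega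
  have hn' : p + 2 - 1 = p + 1 := by omega
  have hn'' : p + 2 - 3 = p - 1 := by omega
  constructor
  · simp only [wordsD, Set.mem_ofPred_eq, hn]
    rintro (⟨k, m, h1, h2, h3, rfl⟩ | ⟨k, m, h1, h2, h3, rfl⟩ | ⟨k, m, h1, h2, h3, rfl⟩ |
      ⟨k, m, h1, h2, h3, rfl⟩ | ⟨m, h1, h2, rfl⟩ | ⟨m, h1, h2, rfl⟩ | ⟨k, h1, h2, rfl⟩ |
      ⟨k, h1, h2, rfl⟩ | ⟨m, h1, h2, rfl⟩ | ⟨m, h1, h2, rfl⟩ | rfl | rfl | rfl | rfl | rfl | rfl |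
      rfl)
    · obtain ⟨m, rfl⟩ := Nat.exists_eq_add_of_le' h3
      obtain ⟨k, rfl⟩ := Nat.exists_eq_add_of_le' (show 1 ≤ k by omega)
      exact ⟨0, k, m, ⟨by omega, by simp [codeRows]; omega, by simp [codeRow]; omega⟩, rfl⟩
    · obtain ⟨m, rfl⟩ := Nat.exists_eq_add_of_le' h3
      obtain ⟨k, rfl⟩ := Nat.exists_eq_add_of_le' (show 2 ≤ k by omega)
      exact ⟨1, k, m, ⟨by omega, by simp [codeRows]; omega, by simp [codeRow]; omega⟩, rfl⟩
    · obtain ⟨m, rfl⟩ := Nat.exists_eq_add_of_le' (show 2 ≤ m by omega)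
      obtain ⟨k, rfl⟩ := Nat.exists_eq_add_of_le' (show 3 ≤ k by omega)
      exact ⟨2, k, m, ⟨by omega, by simp [codeRows]; omega, by simp [codeRow]; omega⟩, rfl⟩
    · obtain ⟨m, rfl⟩ := Nat.exists_eq_add_of_le' (show 2 ≤ m by omega)
      obtain ⟨k, rfl⟩ := Nat.exists_eq_add_of_le' (show 2 ≤ k by omega)
      exact ⟨3, k, m, ⟨by omega, by simp [codeRows]; omega, by simp [codeRow]; omega⟩, rfl⟩
    · obtain ⟨m, rfl⟩ := Nat.exists_eq_add_of_le' h2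
      exact ⟨4, 0, m, ⟨by omega, by simp [codeRows], by simp [codeRow]; omega⟩, rfl⟩
    · obtain ⟨m, rfl⟩ := Nat.exists_eq_add_of_le' h2
      exact ⟨5, 0, m, ⟨by omega, by simp [codeRows], by simp [codeRow]; omega⟩, rfl⟩
    · obtain ⟨k, rfl⟩ := Nat.exists_eq_add_of_le' h2
      exact ⟨2, k, 0, ⟨by omega, by simp [codeRows]; omega, by simp [codeRow]⟩, rfl⟩
    · obtain ⟨k, rfl⟩ := Nat.exists_eq_add_of_le' h2
      exact ⟨3, k, 0, ⟨by omega, by simp [codeRows]; omega, by simp [codeRow]⟩, rfl⟩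
    · obtain ⟨m, rfl⟩ := Nat.exists_eq_add_of_le' (show 2 ≤ m by omega)
      exact ⟨6, 0, m, ⟨by omega, by simp [codeRows], by simp [codeRow]; omega⟩, rfl⟩
    · obtain ⟨m, rfl⟩ := Nat.exists_eq_add_of_le' (show 2 ≤ m by omega)
      exact ⟨7, 0, m, ⟨by omega, by simp [codeRows], by simp [codeRow]; omega⟩, rfl⟩
    · exact ⟨8, 0, 0, ⟨by omega, by simp [codeRows], by simp [codeRow]⟩, rfl⟩
    · exact ⟨9, 0, 0, ⟨by omega, by simp [codeRows], by simp [codeRow]⟩, rfl⟩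
    · exact ⟨6, 0, 0, ⟨by omega, by simp [codeRows], by simp [codeRow]; omega⟩, rfl⟩
    · exact ⟨7, 0, 0, ⟨by omega, by simp [codeRows], by simp [codeRow]; omega⟩, rfl⟩
    · exact ⟨10, 0, 0, ⟨by omega, by simp [codeRows], by simp [codeRow]⟩, rfl⟩
    · exact ⟨11, 0, 0, ⟨by omega, by simp [codeRows], by simp [codeRow]⟩, rfl⟩
    · exact ⟨12, 0, 0, ⟨by omega, by simp [codeRows], by simp [codeRow]⟩, rfl⟩
  · rintro ⟨c, k, i, ⟨hc, hk, hi⟩, rfl⟩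
    simp only [wordsD, Set.mem_ofPred_eq, hn]
    interval_cases c <;> simp only [codeRows, codeRow] at hk hi
    · exact .inl ⟨k + 1, i + 1, by omega, by omega, by omega, rfl⟩
    · exact .inr <| .inl ⟨k + 2, i + 1, by omega, by omega, by omega, rfl⟩
    · rcases Nat.eq_zero_or_pos i with rfl | hi0
      · exact .inr <| .inr <| .inr <| .inr <| .inr <| .inr <| .inl ⟨k + 3, by omega, by omega, rfl⟩
      · exact .inr <| .inr <| .inl ⟨k + 3, i + 2, by omega, by omega, by omega, rfl⟩
    · rcases Nat.eq_zero_or_pos i with rfl | hi0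
      · exact .inr <| .inr <| .inr <| .inr <| .inr <| .inr <| .inr <| .inl
          ⟨k + 2, by omega, by omega, rfl⟩
      · exact .inr <| .inr <| .inr <| .inl ⟨k + 2, i + 2, by omega, by omega, by omega, rfl⟩
    · exact .inr <| .inr <| .inr <| .inr <| .inl ⟨i + 1, by omega, by omega, rfl⟩
    · exact .inr <| .inr <| .inr <| .inr <| .inr <| .inl ⟨i + 1, by omega, by omega, rfl⟩
    · rcases Nat.eq_zero_or_pos i with rfl | hi0
      · exact .inr <| .inr <| .inr <| .inr <| .inr <| .inr <| .inr <| .inr <| .inr <| .inr <|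
          .inr <| .inr <| .inl rfl
      · exact .inr <| .inr <| .inr <| .inr <| .inr <| .inr <| .inr <| .inr <| .inl
          ⟨i + 2, by omega, by omega, rfl⟩
    · rcases Nat.eq_zero_or_pos i with rfl | hi0
      · exact .inr <| .inr <| .inr <| .inr <| .inr <| .inr <| .inr <| .inr <| .inr <| .inr <|
          .inr <| .inr <| .inr <| .inl rfl
      · exact .inr <| .inr <| .inr <| .inr <| .inr <| .inr <| .inr <| .inr <| .inr <| .inl
          ⟨i + 2, by omega, by omega, rfl⟩
    · exact .inr <| .inr <| .inr <| .inr <| .inr <| .inr <| .inr <| .inr <| .inr <| .inr <|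
          .inl rfl
    · exact .inr <| .inr <| .inr <| .inr <| .inr <| .inr <| .inr <| .inr <| .inr <| .inr <|
          .inr <| .inl rfl
    · exact .inr <| .inr <| .inr <| .inr <| .inr <| .inr <| .inr <| .inr <| .inr <| .inr <|
          .inr <| .inr <| .inr <| .inr <| .inl rfl
    · exact .inr <| .inr <| .inr <| .inr <| .inr <| .inr <| .inr <| .inr <| .inr <| .inr <|
          .inr <| .inr <| .inr <| .inr <| .inr <| .inl rfl
    · exact .inr <| .inr <| .inr <| .inr <| .inr <| .inr <| .inr <| .inr <| .inr <| .inr <|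
          .inr <| .inr <| .inr <| .inr <| .inr <| .inr rfl

theorem letters_codeWord {p c k i : ℕ} (hp : 3 ≤ p) (h : IsCode p c k i) {a : ℕ}
    (ha : a ∈ codeWord p c k i) : 1 ≤ a ∧ a ≤ p + 2 := by
  obtain ⟨hc, hk, hi⟩ := h
  have e : upDown (p - 1) 1 = zig (p - 2) ++ [1] := by
    rw [show p - 1 = p - 2 + 1 by omega, upDown_eq]
  interval_cases c <;> simp only [codeRows, codeRow] at hk hi <;>
    simp only [codeWord, upDown_eq, e, List.mem_append, List.mem_cons, List.not_mem_nil, mem_up,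
      mem_down, mem_zig, or_false] at ha <;>
    omega

open Finset in
theorem ncard_wordsD {p : ℕ} (hp : 3 ≤ p) : (wordsD (p + 2)).ncard = 2 * p ^ 2 + 7 * p + 6 := by
  set T : Finset (Σ _ : ℕ, Σ _ : ℕ, ℕ) := (range 13).sigma fun c =>
    (range (codeRows p c)).sigma fun k => range (codeRow p c k) with hT
  have hm (s : Σ _ : ℕ, Σ _ : ℕ, ℕ) : s ∈ T ↔ IsCode p s.1 s.2.1 s.2.2 := by
    simp [hT, IsCode]
  have hw : wordsD (p + 2) = (fun s : Σ _ : ℕ, Σ _ : ℕ, ℕ => codeWord p s.1 s.2.1 s.2.2) '' T := by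
    ext w
    rw [mem_wordsD_iff hp]
    constructor
    · rintro ⟨c, k, i, h, rfl⟩
      exact ⟨⟨c, k, i⟩, (hm _).2 h, rfl⟩
    · rintro ⟨⟨c, k, i⟩, h, rfl⟩
      exact ⟨c, k, i, (hm _).1 h, rfl⟩
  rw [hw, Set.InjOn.ncard_image, Set.ncard_coe_finset, hT, card_sigma]
  · obtain ⟨q, rfl⟩ := Nat.exists_eq_add_of_le' (show 1 ≤ p by omega)
    have g1 (N : ℕ) : (∑ k ∈ range N, (k + 1)) * 2 = N * (N + 1) := by
      induction N with
      | zero => rfl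
      | succ N ih => rw [sum_range_succ, add_mul, ih]; ring
    have g2 (N : ℕ) : (∑ k ∈ range N, (k + 2)) * 2 = N * (N + 3) := by
      induction N with
      | zero => rfl
      | succ N ih => rw [sum_range_succ, add_mul, ih]; ring
    have h1 := g1 (q + 1 + 2)
    have h2 := g1 q
    have h3 := g2 (q + 1)
    simp only [card_sigma, card_range, sum_range_succ _ 12, sum_range_succ _ 11,
      sum_range_succ _ 10, sum_range_succ _ 9, sum_range_succ _ 8, sum_range_succ _ 7,
      sum_range_succ _ 6, sum_range_succ _ 5, sum_range_succ _ 4, sum_range_succ _ 3,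
      sum_range_succ _ 2, sum_range_succ _ 1, sum_range_succ _ 0, sum_range_zero, codeRows, codeRow,
      Nat.add_sub_cancel, zero_add]
    nlinarith
  · rintro ⟨c, k, i⟩ h ⟨c', k', i'⟩ h' he
    obtain ⟨rfl, rfl, rfl⟩ := codeWord_injective hp ((hm _).1 h) ((hm _).1 h') he
    rfl

/-- The codes of the words that are of type `D` but not of type `B`. -/
def IsRemoved (p c k i : ℕ) : Prop :=
  (c = 0 ∧ k = p + 1 ∧ i = p) ∨ (c = 2 ∧ k + 1 = p ∧ i = p) ∨ c = 5 ∨ c = 7 ∨ c = 9 ∨ c = 12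

theorem mem_wordsB_iff {p : ℕ} (hp : 3 ≤ p) {w : List ℕ} :
    w ∈ wordsB (p + 2) ↔ ∃ c k i, IsCode p c k i ∧ ¬IsRemoved p c k i ∧ w = codeWord p c k i := by
  have hn : p + 2 - 2 = p := by omega
  have hr {c k i : ℕ} (h : IsCode p c k i) : codeWord p c k i ∈ {w | w = y1 (p + 2) (p + 2 - 1) ∨
      w = y3 (p + 2) (p + 2) ∨ (∃ m, p + 2 - 2 ≥ m ∧ m ≥ 1 ∧ w = y6 (p + 2) m) ∨
      (∃ m, p + 2 - 2 ≥ m ∧ m ≥ 3 ∧ w = y10 (p + 2) m) ∨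
      w = y12 (p + 2) ∨ w = y14 (p + 2) ∨ w = y17 (p + 2)} ↔ IsRemoved p c k i := by
    simp only [Set.mem_ofPred_eq, hn]
    have inj {c' k' i' : ℕ} (h' : IsCode p c' k' i')
        (e : codeWord p c k i = codeWord p c' k' i') := codeWord_injective hp h h' e
    constructor
    · rintro (e | e | ⟨m, h1, h2, e⟩ | ⟨m, h1, h2, e⟩ | e | e | e)
      · obtain ⟨rfl, rfl, rfl⟩ := inj (c' := 0) (k' := p + 1) (i' := p)
          ⟨by omega, by simp [codeRows], by simp [codeRow]⟩ e
        simp [IsRemoved]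
      · obtain ⟨q, rfl⟩ := Nat.exists_eq_add_of_le' (show 1 ≤ p by omega)
        obtain ⟨rfl, rfl, rfl⟩ := inj (c' := 2) (k' := q) (i' := q + 1)
          ⟨by omega, by simp [codeRows], by simp [codeRow]⟩ e
        simp [IsRemoved]
      · obtain ⟨m, rfl⟩ := Nat.exists_eq_add_of_le' h2
        obtain ⟨rfl, rfl, rfl⟩ := inj (c' := 5) (k' := 0) (i' := m)
          ⟨by omega, by simp [codeRows], by simp [codeRow]; omega⟩ e
        simp [IsRemoved]
      · obtain ⟨m, rfl⟩ := Nat.exists_eq_add_of_le' (show 2 ≤ m by omega)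
        obtain ⟨rfl, rfl, rfl⟩ := inj (c' := 7) (k' := 0) (i' := m)
          ⟨by omega, by simp [codeRows], by simp [codeRow]; omega⟩ e
        simp [IsRemoved]
      · obtain ⟨rfl, rfl, rfl⟩ := inj (c' := 9) (k' := 0) (i' := 0)
          ⟨by omega, by simp [codeRows], by simp [codeRow]⟩ e
        simp [IsRemoved]
      · obtain ⟨rfl, rfl, rfl⟩ := inj (c' := 7) (k' := 0) (i' := 0)
          ⟨by omega, by simp [codeRows], by simp [codeRow]; omega⟩ e
        simp [IsRemoved]
      · obtain ⟨rfl, rfl, rfl⟩ := inj (c' := 12) (k' := 0) (i' := 0)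
          ⟨by omega, by simp [codeRows], by simp [codeRow]⟩ e
        simp [IsRemoved]
    · obtain ⟨hc, hk, hi⟩ := h
      rintro (⟨rfl, rfl, rfl⟩ | ⟨rfl, rfl, rfl⟩ | rfl | rfl | rfl | rfl)
      · exact .inl rfl
      · exact .inr <| .inl rfl
      · simp only [codeRow] at hi
        exact .inr <| .inr <| .inl ⟨i + 1, by omega, by omega, rfl⟩
      · simp only [codeRow] at hi
        rcases Nat.eq_zero_or_pos i with rfl | hi0
        · exact .inr <| .inr <| .inr <| .inr <| .inr <| .inl rfl
        · exact .inr <| .inr <| .inr <| .inl ⟨i + 2, by omega, by omega, rfl⟩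
      · exact .inr <| .inr <| .inr <| .inr <| .inl rfl
      · exact .inr <| .inr <| .inr <| .inr <| .inr <| .inr rfl
  rw [wordsB, Set.mem_sdiff, mem_wordsD_iff hp]
  constructor
  · rintro ⟨⟨c, k, i, h, rfl⟩, h'⟩
    exact ⟨c, k, i, h, fun h'' => h' ((hr h).2 h''), rfl⟩
  · rintro ⟨c, k, i, h, h', rfl⟩
    exact ⟨⟨c, k, i, h, rfl⟩, fun h'' => h' ((hr h).1 h'')⟩

-- The complement in type D is counted instead: it has 1 + 1 + p + (p - 1) + 1 + 1 = 2p + 3 words.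
open Finset in
theorem ncard_wordsB {p : ℕ} (hp : 3 ≤ p) : (wordsB (p + 2)).ncard = 2 * p ^ 2 + 5 * p + 3 := by
  set T : Finset (Σ _ : ℕ, ℕ) := (range 6).sigma fun c =>
    range (if c = 2 then p else if c = 3 then p - 1 else 1) with hT
  set g : (Σ _ : ℕ, ℕ) → ℕ × ℕ × ℕ := fun s => match s with
    | ⟨0, _⟩ => (0, p + 1, p)
    | ⟨1, _⟩ => (2, p - 1, p)
    | ⟨2, i⟩ => (5, 0, i)
    | ⟨3, i⟩ => (7, 0, i)
    | ⟨4, _⟩ => (9, 0, 0)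
    | ⟨_, _⟩ => (12, 0, 0) with hg
  have hm (s : Σ _ : ℕ, ℕ) (hs : s ∈ T) :
      IsCode p (g s).1 (g s).2.1 (g s).2.2 ∧ IsRemoved p (g s).1 (g s).2.1 (g s).2.2 := by
    obtain ⟨c, i⟩ := s
    simp only [hT, mem_sigma, mem_range] at hs
    obtain ⟨hc, hi⟩ := hs
    interval_cases c <;> simp [hg, IsCode, codeRows, codeRow, IsRemoved] at hi ⊢ <;> omega
  have hw : (wordsD (p + 2)) \ wordsB (p + 2) =
      (fun s => codeWord p (g s).1 (g s).2.1 (g s).2.2) '' T := by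
    ext w
    rw [Set.mem_sdiff, mem_wordsD_iff hp, mem_wordsB_iff hp]
    constructor
    · rintro ⟨⟨c, k, i, h, rfl⟩, h'⟩
      have h'' : IsRemoved p c k i := by_contra fun h'' => h' ⟨c, k, i, h, h'', rfl⟩
      obtain ⟨hc, hk, hi⟩ := h
      rcases h'' with ⟨rfl, rfl, rfl⟩ | ⟨rfl, rfl, rfl⟩ | rfl | rfl | rfl | rfl
      · exact ⟨⟨0, 0⟩, by simp [hT], rfl⟩
      · exact ⟨⟨1, 0⟩, by simp [hT], rfl⟩
      · exact ⟨⟨2, i⟩, by simpa [hT, codeRow] using hi, rfl⟩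
      · exact ⟨⟨3, i⟩, by simpa [hT, codeRow] using hi, rfl⟩
      · exact ⟨⟨4, 0⟩, by simp [hT], rfl⟩
      · exact ⟨⟨5, 0⟩, by simp [hT], rfl⟩
    · rintro ⟨s, hs, rfl⟩
      obtain ⟨h1, h2⟩ := hm s hs
      refine ⟨⟨_, _, _, h1, rfl⟩, ?_⟩
      rintro ⟨c, k, i, h3, h4, e⟩
      obtain ⟨rfl, rfl, rfl⟩ := codeWord_injective hp h1 h3 e
      exact h4 h2
  have hc : ((fun s => codeWord p (g s).1 (g s).2.1 (g s).2.2) '' (T : Set _)).ncard =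
      2 * p + 3 := by
    rw [Set.InjOn.ncard_image, Set.ncard_coe_finset, hT, card_sigma]
    · simp [sum_range_succ]
      omega
    · intro s hs s' hs' he
      obtain ⟨e1, e2, e3⟩ := codeWord_injective hp (hm s hs).1 (hm s' hs').1 he
      obtain ⟨c, i⟩ := s
      obtain ⟨c', i'⟩ := s'
      simp only [hT, coe_sigma, Set.mem_sigma_iff, mem_coe, mem_range] at hs hs'
      obtain ⟨hc, hi⟩ := hs
      obtain ⟨hc', hi'⟩ := hs'
      interval_cases c <;> interval_cases c' <;> simp [hg] at e1 e3 hi hi' ⊢ <;> omega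
  have hsub : wordsB (p + 2) ⊆ wordsD (p + 2) := Set.sdiff_subset
  have hfin : (wordsD (p + 2)).Finite :=
    Set.finite_of_ncard_pos (by rw [ncard_wordsD hp]; positivity)
  have h := Set.ncard_sdiff_add_ncard_of_subset hsub hfin
  rw [hw, hc, ncard_wordsD hp] at h
  omega

theorem map_val_image_onVertices {n : ℕ} {S : Set (List ℕ)}
    (h : ∀ w ∈ S, ∀ a ∈ w, 1 ≤ a ∧ a ≤ n) : List.map Subtype.val '' onVertices n S = S := by
  ext w
  constructor
  · rintro ⟨v, hv, rfl⟩
    exact hv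
  · intro hw
    lift w to List (Vertex n) using h w hw
    exact ⟨w, hw, rfl⟩

theorem ncard_onVertices {n : ℕ} {S : Set (List ℕ)}
    (h : ∀ w ∈ S, ∀ a ∈ w, 1 ≤ a ∧ a ≤ n) : (onVertices n S).ncard = S.ncard := by
  rw [← Set.ncard_image_of_injective _ (List.map_injective_iff.2 Subtype.val_injective),
    map_val_image_onVertices h]

end Count

/-! ### Values of the words and stability of their span -/

section Values

variable {G : Type*} [LieRing G] {p : ℕ} {x : ℕ → G} {S : AddSubgroup G}

theorem wordValue_append (x : ℕ → G) (u v : List ℕ) (hv : v ≠ []) :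
    wordValue x (u ++ v) = act x u (wordValue x v) := by
  rw [← List.dropLast_append_getLast hv, ← List.append_assoc, wordValue_concat, wordValue_concat,
    act_append]

theorem wordValue_down (x : ℕ → G) {k m : ℕ} (h : m ≤ k) :
    wordValue x (down k m) = act x (down k (m + 1)) (x m) := by
  rw [down_concat h, wordValue_concat]

theorem act_zig (x : ℕ → G) (j : ℕ) : act x (zig j) (x 1) = zigzag x j := by
  induction j with
  | zero => simp [zig, down, up, zigzag]
  | succ j ih =>
    rw [zig, down_succ_cons (by omega), List.flatMap_cons, act_append, ← zig, ih]; rfl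

theorem wordValue_upDown (x : ℕ → G) (j : ℕ) : wordValue x (upDown (j + 1) 1) = zigzag x j := by
  rw [upDown_eq, wordValue_concat, act_zig]

/-- The value of `codeWord p c k i`. -/
def codeValue (p : ℕ) (x : ℕ → G) : ℕ → ℕ → ℕ → G
  | 0, k, i => act x (down (k + 1) (i + 2)) (x (i + 1))
  | 1, k, i => act x (up (k + 2) p) (act x (down (p + 2) (i + 2)) (x (i + 1)))
  | 2, k, i => act x (down (k + 3) (i + 3)) (zigzag x i)
  | 3, k, i => act x (up (k + 2) p) (act x (down (p + 2) (i + 3)) (zigzag x i))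
  | 4, _, i => ⁅x (p + 2), act x (down p (i + 2)) (x (i + 1))⁆
  | 5, _, i => ⁅x (p + 1), ⁅x (p + 2), act x (down p (i + 2)) (x (i + 1))⁆⁆
  | 6, _, i => ⁅x (p + 2), act x (down p (i + 3)) (zigzag x i)⁆
  | 7, _, i => ⁅x (p + 1), ⁅x (p + 2), act x (down p (i + 3)) (zigzag x i)⁆⁆
  | 8, _, _ => ⁅x 1, act x (up 3 p) (act x (down (p + 2) 2) (x 1))⁆
  | 9, _, _ => ⁅x 1, act x (up 3 p) (act x (down (p + 2) 3) (x 2))⁆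
  | 10, _, _ => ⁅x p, ⁅x (p + 2), zigzag x (p - 2)⁆⁆
  | 11, _, _ => ⁅x (p + 1), ⁅x p, ⁅x (p + 2), zigzag x (p - 2)⁆⁆⁆
  | _, _, _ => ⁅x (p + 2), ⁅x (p + 1), ⁅x p, ⁅x (p + 2), zigzag x (p - 2)⁆⁆⁆⁆

theorem wordValue_codeWord (x : ℕ → G) {c k i : ℕ} (hp : 3 ≤ p) (h : IsCode p c k i) :
    wordValue x (codeWord p c k i) = codeValue p x c k i := by
  obtain ⟨hc, hk, hi⟩ := h
  have ne {a b : ℕ} (h : a ≤ b) : down b a ≠ [] := by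
    rw [down_concat h]; simp
  have ne' (j : ℕ) : upDown j 1 ≠ [] := by simp [upDown]
  have e : upDown (p - 1) 1 = upDown (p - 2 + 1) 1 := by
    rw [show p - 1 = p - 2 + 1 by omega]
  interval_cases c <;> simp only [codeRows, codeRow] at hk hi <;>
    simp only [codeWord, codeValue, e]
  · rw [wordValue_down x (by omega)]
  · rw [wordValue_append _ _ _ (ne (by omega)), wordValue_down x (by omega)]
  · rw [wordValue_append _ _ _ (ne' _), wordValue_upDown]
  · rw [wordValue_append _ _ _ (ne' _), wordValue_upDown, act_append]
  · rw [wordValue_append _ _ _ (ne (by omega)), wordValue_down x (by omega)]; rfl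
  · rw [wordValue_append _ _ _ (ne (by omega)), wordValue_down x (by omega)]; rfl
  · rw [wordValue_append _ _ _ (ne' _), wordValue_upDown, act_append]; rfl
  · rw [wordValue_append _ _ _ (ne' _), wordValue_upDown, act_append]; rfl
  · rw [wordValue_append _ _ _ (ne (by omega)), wordValue_down x (by omega), act_append]; rfl
  · rw [wordValue_append _ _ _ (ne (by omega)), wordValue_down x (by omega), act_append]; rfl
  · rw [wordValue_append _ _ _ (ne' _), wordValue_upDown]; rfl
  · rw [wordValue_append _ _ _ (ne' _), wordValue_upDown]; rfl
  · rw [wordValue_append _ _ _ (ne' _), wordValue_upDown]; rfl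

theorem containsAllD_of_codes (hp : 3 ≤ p)
    (h : ∀ c k i, IsCode p c k i → codeValue p x c k i ∈ S) : ContainsAllD p x S where
  chain m k hm hmk hk := by
    obtain ⟨m, rfl⟩ := Nat.exists_eq_add_of_le' hm
    obtain ⟨k, rfl⟩ := Nat.exists_eq_add_of_le' (hm.trans hmk)
    exact h 0 k m ⟨by omega, by simp [codeRows]; omega, by simp [codeRow]; omega⟩
  zchain j k hj hk := by
    -- For k = 2 the value is x_1 itself, which is coded in family 0.
    rcases (show k = 2 ∨ 3 ≤ k by omega) with rfl | h3
    · obtain rfl : j = 0 := by omega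
      simpa [codeValue, down, up, zigzag] using
        h 0 0 0 ⟨by omega, by simp [codeRows], by simp [codeRow]⟩
    · obtain ⟨k, rfl⟩ := Nat.exists_eq_add_of_le' h3
      exact h 2 k j ⟨by omega, by simp [codeRows]; omega, by simp [codeRow]; omega⟩
  turn m k hm hmk hk := by
    obtain ⟨m, rfl⟩ := Nat.exists_eq_add_of_le' hm
    obtain ⟨k, rfl⟩ := Nat.exists_eq_add_of_le' (show 2 ≤ k by omega)
    exact h 1 k m ⟨by omega, by simp [codeRows]; omega, by simp [codeRow]; omega⟩
  zturn j k hj hk := by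
    obtain ⟨k, rfl⟩ := Nat.exists_eq_add_of_le' (show 2 ≤ k by omega)
    exact h 3 k j ⟨by omega, by simp [codeRows]; omega, by simp [codeRow]; omega⟩
  one_one := h 8 0 0 ⟨by omega, by simp [codeRows], by simp [codeRow]⟩
  one_two := h 9 0 0 ⟨by omega, by simp [codeRows], by simp [codeRow]⟩
  side m hm hmp := by
    obtain ⟨m, rfl⟩ := Nat.exists_eq_add_of_le' hm
    exact h 4 0 m ⟨by omega, by simp [codeRows], by simp [codeRow]; omega⟩
  zside j hj := h 6 0 j ⟨by omega, by simp [codeRows], by simp [codeRow]; omega⟩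
  side_start := by
    obtain ⟨q, rfl⟩ := Nat.exists_eq_add_of_le' (show 1 ≤ p by omega)
    simpa [codeValue, down, up] using
      h 5 0 q ⟨by omega, by simp [codeRows], by simp [codeRow]⟩
  side' m hm hmp := by
    obtain ⟨m, rfl⟩ := Nat.exists_eq_add_of_le' hm
    exact h 5 0 m ⟨by omega, by simp [codeRows], by simp [codeRow]; omega⟩
  zside' j hj := h 7 0 j ⟨by omega, by simp [codeRows], by simp [codeRow]; omega⟩
  top := h 10 0 0 ⟨by omega, by simp [codeRows], by simp [codeRow]⟩
  top' := h 11 0 0 ⟨by omega, by simp [codeRows], by simp [codeRow]⟩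
  top'' := h 12 0 0 ⟨by omega, by simp [codeRows], by simp [codeRow]⟩

theorem lie_mem_of_swapTop {e : G} (h : ∀ i, 1 ≤ i → i ≤ p + 2 → ⁅swapTop p x i, e⁆ ∈ S) {i : ℕ}
    (hi : 1 ≤ i) (hip : i ≤ p + 2) : ⁅x i, e⁆ ∈ S := by
  rcases (show i ≤ p ∨ i = p + 1 ∨ i = p + 2 by omega) with h' | rfl | rfl
  · simpa [swapTop_of_le h'] using h i hi hip
  · simpa [swapTop_second] using h (p + 2) (by omega) le_rfl
  · simpa [swapTop_first] using h (p + 1) (by omega) (by omega)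

/-- Families 0 to 3, 8 and 9 are covered directly. Families 4 to 7 and 10 to 12 are chains and
zigzag chains in the swapped generators, so `lie_chain_mem` and `lie_zchain_mem` apply to those. -/
theorem SandwichD.lie_codeValue_mem (R : SandwichD p x) (C : ContainsAllD p x S) {c k i : ℕ}
    (h : IsCode p c k i) {a : ℕ} (ha : 1 ≤ a) (hap : a ≤ p + 2) :
    ⁅x a, codeValue p x c k i⁆ ∈ S := by
  have hp := R.three_le
  have R' := R.swapTop
  have C' := C.containsD_swapTop R
  have C0 := C.toContainsD
  obtain ⟨hc, hk, hi⟩ := h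
  interval_cases c <;> simp only [codeRows, codeRow] at hk hi <;> simp only [codeValue]
  · exact R.lie_chain_mem C0 ha hap (by omega) (by omega) (by omega)
  · exact R.lie_turn_mem C0 ha hap (by omega) (by omega) (by omega)
  · exact R.lie_zchain_mem C0 ha hap (by omega) (by omega)
  · exact R.lie_zturn_mem C0 ha hap (by omega) (by omega)
  · refine lie_mem_of_swapTop (p := p) (fun a ha hap => ?_) ha hap
    have h := R'.lie_chain_mem C' ha hap (m := i + 1) (k := p + 1) (by omega) (by omega) (by omega)
    rwa [act_down_succ _ (by omega), act_down_swapTop le_rfl, swapTop_first,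
      swapTop_of_le (i := i + 1) (by omega)] at h
  · refine lie_mem_of_swapTop (p := p) (fun a ha hap => ?_) ha hap
    have h := R'.lie_chain_mem C' ha hap (m := i + 1) (k := p + 2) (by omega) (by omega) (by omega)
    rwa [act_down_succ _ (by omega), act_down_succ _ (by omega), act_down_swapTop le_rfl,
      show p + 1 + 1 = p + 2 from rfl, swapTop_second, swapTop_first,
      swapTop_of_le (i := i + 1) (by omega)] at h
  · refine lie_mem_of_swapTop (p := p) (fun a ha hap => ?_) ha hap
    have h := R'.lie_zchain_mem C' ha hap (j := i) (k := p + 1) (by omega) (by omega)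
    rwa [act_down_succ _ (by omega), act_down_swapTop le_rfl, swapTop_first,
      zigzag_swapTop (by omega)] at h
  · refine lie_mem_of_swapTop (p := p) (fun a ha hap => ?_) ha hap
    have h := R'.lie_zchain_mem C' ha hap (j := i) (k := p + 2) (by omega) (by omega)
    rwa [act_down_succ _ (by omega), act_down_succ _ (by omega), act_down_swapTop le_rfl,
      show p + 1 + 1 = p + 2 from rfl, swapTop_second, swapTop_first,
      zigzag_swapTop (by omega)] at h
  · rw [R.lie_one_one ha hap]
    exact S.zero_mem
  · exact R.lie_one_two_mem C0 ha hap
  · refine lie_mem_of_swapTop (p := p) (fun a ha hap => ?_) ha hap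
    have h := R'.lie_zchain_mem C' ha hap (j := p - 1) (k := p + 1) (by omega) (by omega)
    rwa [act_down_nil _ (by omega), zigzag_swapTop_pred hp] at h
  · refine lie_mem_of_swapTop (p := p) (fun a ha hap => ?_) ha hap
    have h := R'.lie_zchain_mem C' ha hap (j := p - 1) (k := p + 2) (by omega) (by omega)
    rwa [act_down_succ _ (by omega), act_down_nil _ (by omega), zigzag_swapTop_pred hp,
      show p + 1 + 1 = p + 2 from rfl, swapTop_second] at h
  · refine lie_mem_of_swapTop (p := p) (fun a ha hap => ?_) ha hap
    have h := R'.lie_zchain_mem C' ha hap (j := p) (k := p + 2) (by omega) (by omega)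
    rwa [act_down_nil _ (by omega), zigzag_swapTop_self hp] at h

end Values

/-! ### The spanning theorem for degenerate generators in the four types -/

section Span

variable {K : Type*} [Field K] {V G : Type*} [LieRing G] [LieAlgebra K G]

theorem wordValue_map {W : Type*} (x : W → G) (f : V → W) (w : List V) :
    wordValue x (w.map f) = wordValue (x ∘ f) w := by
  induction w with
  | nil => rfl
  | cons i w ih =>
    cases w with
    | nil => rfl
    | cons j w => simpa [wordValue] using congrArg (fun v => ⁅x (f i), v⁆) ih

theorem wordValue_eq_zero {x : V → G} {w : List V} {a : V} (ha : a ∈ w) (h : x a = 0) :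
    wordValue x w = 0 := by
  induction w with
  | nil => rfl
  | cons i w ih =>
    cases w with
    | nil =>
      obtain rfl : a = i := by simpa using ha
      exact h
    | cons j w =>
      rw [wordValue]
      rcases List.mem_cons.1 ha with rfl | ha
      · rw [h, zero_lie]
      · rw [ih ha, lie_zero]

/-- A subspace that contains the generators and is stable under them contains all monomials. -/
theorem monomialValue_mem (y : V → G) (S : Submodule K G) (hy : ∀ i, y i ∈ S)
    (h : ∀ i, ∀ s ∈ S, ⁅y i, s⁆ ∈ S) (m : FreeMagma V) : monomialValue y m ∈ S := by
  -- The induction needs stability under whole monomials too; it passes to brackets by the Jacobi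
  -- identity.
  suffices monomialValue y m ∈ S ∧ ∀ s ∈ S, ⁅monomialValue y m, s⁆ ∈ S from this.1
  induction m with
  | ih1 i => exact ⟨hy i, h i⟩
  | ih2 a b iha ihb =>
    refine ⟨iha.2 _ ihb.1, fun s hs => ?_⟩
    change ⁅⁅monomialValue y a, monomialValue y b⁆, s⁆ ∈ S
    rw [lie_lie]
    exact S.sub_mem (iha.2 _ (ihb.2 _ hs)) (ihb.2 _ (iha.2 _ hs))

/-- The generators `y_i` commute along non-edges of `Γ` and satisfy `⁅y_i, ⁅y_i, v⁆⁆ = 0`. -/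
structure Degenerate (Γ : SimpleGraph V) (y : V → G) : Prop where
  comm : ∀ i j, ¬Γ.Adj i j → ⁅y i, y j⁆ = 0
  sq : ∀ i (v : G), ⁅y i, ⁅y i, v⁆⁆ = 0

/-- Expanding ⁅a, ⁅a, ⁅u, v⁆⁆⁆ = 0 by Jacobi leaves twice the desired element. This is where the
characteristic enters. -/
theorem lie_lie_lie_eq_zero (h2 : ringChar K ≠ 2) {a : G} (ha : ∀ v : G, ⁅a, ⁅a, v⁆⁆ = 0)
    (u v : G) : ⁅a, ⁅u, ⁅a, v⁆⁆⁆ = 0 := by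
  have h := ha ⁅u, v⁆
  rw [leibniz_lie a u v, lie_add, leibniz_lie a ⁅a, u⁆ v, ha, zero_lie, zero_add, lie_lie a u,
    ha, lie_zero, sub_zero, ← two_smul K] at h
  exact (smul_eq_zero.1 h).resolve_left (Ring.two_ne_zero h2)

variable {n : ℕ}

/-- Extend a family indexed by `1, …, n` by zero. -/
def extendZero (y : Vertex n → G) (i : ℕ) : G := if h : 1 ≤ i ∧ i ≤ n then y ⟨i, h⟩ else 0

theorem extendZero_val (y : Vertex n → G) (i : Vertex n) : extendZero y i.1 = y i := by
  rw [extendZero, dif_pos i.2]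

theorem extendZero_of_not (y : Vertex n → G) {i : ℕ} (h : ¬(1 ≤ i ∧ i ≤ n)) :
    extendZero y i = 0 := by
  rw [extendZero, dif_neg h]

theorem Degenerate.sandwichD (h2 : ringChar K ≠ 2) {Γ : SimpleGraph (Vertex n)} {y : Vertex n → G}
    (D : Degenerate Γ y) {p : ℕ} (hp : 3 ≤ p) (hΓ : ∀ i j, Far p i.1 j.1 → ¬Γ.Adj i j) :
    SandwichD p (extendZero y) := by
  have sq (i : ℕ) (v : G) : ⁅extendZero y i, ⁅extendZero y i, v⁆⁆ = 0 := by
    unfold extendZero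
    split_ifs
    · exact D.sq _ _
    · simp
  refine ⟨hp, fun i j h => ?_, sq, fun i u v => lie_lie_lie_eq_zero h2 (sq i) u v⟩
  unfold extendZero
  split_ifs
  · exact D.comm _ _ (hΓ _ _ h)
  all_goals simp

theorem wordValue_mem_span (y : Vertex n → G) {M : Set (List ℕ)} {w : List ℕ} (hw : w ∈ M)
    (h : ∀ a ∈ w, 1 ≤ a ∧ a ≤ n) :
    wordValue (extendZero y) w ∈ Submodule.span K (wordValue y '' onVertices n M) := by
  lift w to List (Vertex n) using h
  refine Submodule.subset_span ⟨w, hw, ?_⟩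
  rw [wordValue_map]
  congr 1
  exact funext fun i => (extendZero_val y i).symm

/-- The graph of type D may have more vertices than there are generators: words with a letter beyond
n have value 0, so only words in existing letters need to lie in S. -/
theorem SandwichD.monomialValue_mem_span {p : ℕ} {y : Vertex n → G}
    (R : SandwichD p (extendZero y)) (hn : n ≤ p + 2) {S : Submodule K G}
    (hS : ∀ c k i, IsCode p c k i → (∀ a ∈ codeWord p c k i, 1 ≤ a ∧ a ≤ n) →
      codeValue p (extendZero y) c k i ∈ S) (m : FreeMagma (Vertex n)) :
    monomialValue y m ∈ S := by
  have hp := R.three_le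
  set x := extendZero y with hx
  set T : Submodule K G := Submodule.span K {v | ∃ c k i, IsCode p c k i ∧ v = codeValue p x c k i}
    with hT
  have hTS : T ≤ S := by
    refine Submodule.span_le.2 ?_
    rintro _ ⟨c, k, i, h, rfl⟩
    by_cases hl : ∀ a ∈ codeWord p c k i, 1 ≤ a ∧ a ≤ n
    · exact hS c k i h hl
    · push Not at hl
      obtain ⟨a, ha, hl⟩ := hl
      rw [← wordValue_codeWord x hp h, wordValue_eq_zero ha (extendZero_of_not y (by omega))]
      exact S.zero_mem
  have C : ContainsAllD p x T.toAddSubgroup := containsAllD_of_codes hp fun c k i h =>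
    Submodule.subset_span ⟨c, k, i, h, rfl⟩
  refine hTS (monomialValue_mem y T (fun i => ?_) (fun i s hs => ?_) m)
  · have h := C.chain i.1 i.1 i.2.1 le_rfl (i.2.2.trans hn)
    rwa [act_down_nil x (by omega), hx, extendZero_val] at h
  · induction hs using Submodule.span_induction with
    | mem v hv =>
      obtain ⟨c, k, j, h, rfl⟩ := hv
      have h := R.lie_codeValue_mem C h i.2.1 (i.2.2.trans hn)
      rwa [show x i.1 = y i from extendZero_val y i] at h
    | zero => rw [lie_zero]; exact T.zero_mem
    | add u v _ _ hu hv => rw [lie_add]; exact T.add_mem hu hv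
    | smul c v _ hv => rw [lie_smul]; exact T.smul_mem c hv

/-- Every monomial in degenerate generators is a combination of words from `M`. -/
def SpansDegenerate (K : Type*) [Field K] (Γ : SimpleGraph V) (M : Set (List V)) (G : Type*)
    [LieRing G] [LieAlgebra K G] : Prop :=
  ∀ y : V → G, Degenerate Γ y → ∀ m : FreeMagma V,
    monomialValue y m ∈ Submodule.span K (wordValue y '' M)

theorem spansDegenerate_graphD (h2 : ringChar K ≠ 2) {p : ℕ} (hp : 3 ≤ p) :
    SpansDegenerate K (graphD (p + 2)) (monomialsD (p + 2)) G := by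
  intro y D
  have R := D.sandwichD h2 hp fun i j h => by
    simp only [graphD, SimpleGraph.fromRel_adj]; unfold Far at h; omega
  refine R.monomialValue_mem_span le_rfl fun c k i h hl => ?_
  rw [← wordValue_codeWord _ hp h]
  exact wordValue_mem_span y ((mem_wordsD_iff hp).2 ⟨c, k, i, h, rfl⟩) hl

theorem SandwichD.codeWord_mem_wordsA {p : ℕ} (hp : 3 ≤ p) (hn : n < p + 2) {c k i : ℕ}
    (h : IsCode p c k i) (hl : ∀ a ∈ codeWord p c k i, 1 ≤ a ∧ a ≤ n) :
    (c = 0 ∧ codeWord p c k i ∈ wordsC n) ∨ (c = 2 ∧ codeWord p c k i ∈ wordsA n) := by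
  have hc : c = 0 ∨ c = 2 := by
    by_contra hc
    have : p + 2 ∈ codeWord p c k i := by
      obtain ⟨hc', hk, hi⟩ := h
      interval_cases c <;> simp only [codeRows, codeRow] at hk hi <;>
        simp [codeWord, mem_up, mem_down] at hc ⊢ <;> omega
    have := hl _ this
    omega
  obtain ⟨-, hk, hi⟩ := h
  rcases hc with rfl | rfl <;> simp only [codeRows, codeRow] at hk hi
  · have := hl (k + 1) (by simp [codeWord, mem_down]; omega)
    exact .inl ⟨rfl, k + 1, i + 1, by omega, by omega, by omega, rfl⟩
  · have := hl (k + 3) (by simp [codeWord, mem_down, upDown_eq, mem_zig]; omega)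
    refine .inr ⟨rfl, .inr ?_⟩
    rcases Nat.eq_zero_or_pos i with rfl | hi0
    · exact .inr ⟨k + 3, by omega, by omega, rfl⟩
    · exact .inl ⟨k + 3, i + 2, by omega, by omega, by omega, rfl⟩

theorem spansDegenerate_graphA (h2 : ringChar K ≠ 2) :
    SpansDegenerate K (graphA n) (monomialsA n) G := by
  intro y D
  -- The choice p = n + 3 puts the upper triangle of the D graph beyond the vertex n and makes p at
  -- least 3 for every n.
  have hp : 3 ≤ n + 3 := by omega
  have R := D.sandwichD h2 hp fun i j h => by
    have := i.2
    have := j.2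
    simp only [graphA, SimpleGraph.fromRel_adj]; unfold Far at h; omega
  refine R.monomialValue_mem_span (by omega) fun c k i h hl => ?_
  rw [← wordValue_codeWord _ hp h]
  refine wordValue_mem_span y ?_ hl
  rcases SandwichD.codeWord_mem_wordsA hp (by omega) h hl with ⟨-, h⟩ | ⟨-, h⟩
  · exact .inl h
  · exact h

theorem zigzag_eq_zero {x : ℕ → G} (h : ⁅x 3, x 1⁆ = 0) (j : ℕ) : zigzag x (j + 1) = 0 := by
  induction j with
  | zero => simp [zigzag, h]
  | succ j ih => rw [zigzag, ih, lie_zero, lie_zero]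

theorem spansDegenerate_graphC (h2 : ringChar K ≠ 2) :
    SpansDegenerate K (graphC n) (monomialsC n) G := by
  intro y D
  have hp : 3 ≤ n + 3 := by omega
  have R := D.sandwichD h2 hp fun i j h => by
    have := i.2
    have := j.2
    simp only [graphC, SimpleGraph.fromRel_adj]; unfold Far at h; omega
  have h31 : ⁅extendZero y 3, extendZero y 1⁆ = 0 := by
    unfold extendZero
    split_ifs
    · exact D.comm _ _ (by simp [graphC, SimpleGraph.fromRel_adj])
    all_goals simp
  refine R.monomialValue_mem_span (by omega) fun c k i h hl => ?_
  rcases SandwichD.codeWord_mem_wordsA hp (by omega) h hl with ⟨-, h'⟩ | ⟨rfl, -⟩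
  · rw [← wordValue_codeWord _ hp h]
    exact wordValue_mem_span y h' hl
  -- Without the edge {1, 3} every word of this family vanishes, since it ends in x_3 x_1.
  · have e : codeValue (n + 3) (extendZero y) 2 k i = 0 := by
      rw [codeValue]
      cases i with
      | zero => rw [act_down_concat _ (by omega), zigzag, h31, act_zero]
      | succ i => rw [zigzag_eq_zero h31, act_zero]
    rw [e]
    exact Submodule.zero_mem _

/-- As the two top letters commute, each word removed from the list of type D is zero, equal to a
chain that is kept, or (for y^12) reducible by the hard relation. -/
theorem spansDegenerate_graphB (h2 : ringChar K ≠ 2) {p : ℕ} (hp : 3 ≤ p) :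
    SpansDegenerate K (graphB (p + 2)) (monomialsB (p + 2)) G := by
  intro y D
  have R := D.sandwichD h2 hp fun i j h => by
    simp only [graphB, SimpleGraph.fromRel_adj]; unfold Far at h; omega
  set x := extendZero y with hx
  have hc : ⁅x (p + 1), x (p + 2)⁆ = 0 := by
    rw [hx, extendZero, extendZero, dif_pos (by omega), dif_pos (by omega)]
    exact D.comm _ _ (by simp only [graphB, SimpleGraph.fromRel_adj]; omega)
  set S := Submodule.span K (wordValue y '' monomialsB (p + 2)) with hS
  have hB {c k i : ℕ} (h : IsCode p c k i) (hr : ¬IsRemoved p c k i) :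
      codeValue p x c k i ∈ S := by
    rw [← wordValue_codeWord _ hp h]
    exact wordValue_mem_span y ((mem_wordsB_iff hp).2 ⟨c, k, i, h, hr, rfl⟩)
      fun a ha => letters_codeWord hp h ha
  refine R.monomialValue_mem_span le_rfl fun c k i h _ => ?_
  by_cases hr : IsRemoved p c k i
  swap
  · exact hB h hr
  have zero {v : G} (h : v = 0) : v ∈ S := h ▸ S.zero_mem
  obtain ⟨-, hk, hi⟩ := h
  rcases hr with ⟨rfl, rfl, rfl⟩ | ⟨rfl, rfl, rfl⟩ | rfl | rfl | rfl | rfl <;>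
    simp only [codeRows, codeRow] at hk hi
  · refine zero ?_
    change act x (down (i + 2) (i + 2)) (x (i + 1)) = 0
    rw [down_self, act_cons, act_nil, ← lie_skew, hc, neg_zero]
  · refine zero ?_
    rw [codeValue, act_down_nil x (by omega)]
    rcases k with _ | k
    · omega
    · rw [zigzag, zigzag, lie_comm_of hc, R.sand, lie_zero]
  · have h := hB (c := 0) (k := p + 1) (i := i)
      ⟨by omega, by simp [codeRows], by simp [codeRow]; omega⟩ (by simp [IsRemoved]; omega)
    rw [codeValue, act_down_succ x (by omega), act_down_succ x (by omega)] at h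
    rwa [codeValue, lie_comm_of hc]
  · have h := hB (c := 2) (k := p - 1) (i := i)
      ⟨by omega, by simp [codeRows]; omega, by simp [codeRow]; omega⟩ (by simp [IsRemoved]; omega)
    rw [codeValue, show p - 1 + 3 = p + 2 by omega, act_down_succ x (by omega),
      act_down_succ x (by omega)] at h
    rwa [codeValue, lie_comm_of hc]
  -- The hard relation is read backwards: its first term equals a turning word because the top
  -- letters commute, so y^12 lies in S up to sign.
  · have hz : ∀ j k, j + 2 ≤ k → k ≤ p →
        act x (up k p) (act x (down (p + 2) (j + 3)) (zigzag x j)) ∈ S.toAddSubgroup := by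
      intro j k h1 h2
      have h := hB (c := 3) (k := k - 2) (i := j)
        ⟨by omega, by simp [codeRows]; omega, by simp [codeRow]; omega⟩ (by simp [IsRemoved])
      rwa [codeValue, show k - 2 + 2 = k by omega] at h
    have e1 : ⁅x (p + 2), ⁅x p, ⁅x (p + 1), zigzag x (p - 2)⁆⁆⁆ ∈ S := by
      have h := hB (c := 2) (k := p - 1) (i := p - 1)
        ⟨by omega, by simp [codeRows]; omega, by simp [codeRow]⟩ (by simp [IsRemoved]; omega)
      obtain ⟨q, rfl⟩ := Nat.exists_eq_add_of_le' (show 2 ≤ p by omega)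
      change act x (down (q + 4) (q + 4)) (zigzag x (q + 1)) ∈ S at h
      rwa [down_self, act_cons, act_nil, zigzag] at h
    have h := R.hard_relation hz
      (hB (c := 1) (k := 1) (i := 0) ⟨by omega, by simp [codeRows]; omega, by simp [codeRow]⟩
        (by simp [IsRemoved])) e1
      (hB (c := 11) (k := 0) (i := 0) ⟨by omega, by simp [codeRows], by simp [codeRow]⟩
        (by simp [IsRemoved]))
    have h' := hz (p - 2) p (by omega) le_rfl
    rw [show p - 2 + 3 = p + 1 by omega, _root_.up_self, act_cons, act_nil,
      act_down_succ x (by omega), act_down_concat x le_rfl, act_down_nil x (by omega),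
      lie_comm_of (a := x (p + 2)) (b := x (p + 1)) (by rw [← lie_skew, hc, neg_zero])] at h'
    replace h := S.sub_mem h h'
    rw [add_sub_cancel_left] at h
    rcases neg_one_pow_eq_or ℤ p with e | e <;> rw [e] at h
    · rwa [one_smul] at h
    · rwa [neg_smul, one_smul, S.neg_mem_iff] at h
  · refine zero ?_
    change ⁅x (p + 2), ⁅x (p + 1), ⁅x p, ⁅x (p + 2), zigzag x (p - 2)⁆⁆⁆⁆ = 0
    rw [← lie_comm_of hc, R.sand, lie_zero]

end Span

/-! ### Reduction to degenerate generators through the Rees algebra -/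

section Rees

open scoped TensorProduct

variable {K : Type*} [Field K] {V L : Type*} [LieRing L] [LieAlgebra K L]

theorem map_monomialValue {L' : Type*} [LieRing L'] {F : Type*} [FunLike F L L'] (φ : F)
    (hφ : ∀ a b, φ ⁅a, b⁆ = ⁅φ a, φ b⁆) (x : V → L) (m : FreeMagma V) :
    φ (monomialValue x m) = monomialValue (φ ∘ x) m := by
  induction m with
  | ih1 i => rfl
  | ih2 a b iha ihb => exact (hφ _ _).trans (by rw [iha, ihb]; rfl)

theorem map_wordValue {L' : Type*} [LieRing L'] {F : Type*} [FunLike F L L'] [ZeroHomClass F L L']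
    (φ : F) (hφ : ∀ a b, φ ⁅a, b⁆ = ⁅φ a, φ b⁆) (x : V → L) (w : List V) :
    φ (wordValue x w) = wordValue (φ ∘ x) w := by
  induction w with
  | nil => exact map_zero φ
  | cons i w ih =>
    cases w with
    | nil => rfl
    | cons j w => exact (hφ _ _).trans (by rw [ih]; rfl)

/-- The span of the monomials of length at most `d`. -/
def lengthFiltration (K : Type*) [Field K] [LieAlgebra K L] (x : V → L) (d : ℕ) : Submodule K L :=
  Submodule.span K {v | ∃ m : FreeMagma V, m.length ≤ d ∧ v = monomialValue x m}

variable {x : V → L}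

theorem monomialValue_mem_lengthFiltration (m : FreeMagma V) :
    monomialValue x m ∈ lengthFiltration K x m.length :=
  Submodule.subset_span ⟨m, le_rfl, rfl⟩

theorem lengthFiltration_mono {d e : ℕ} (h : d ≤ e) :
    lengthFiltration K x d ≤ lengthFiltration K x e :=
  Submodule.span_mono fun _ ⟨m, hm, hv⟩ => ⟨m, hm.trans h, hv⟩

theorem lie_mem_lengthFiltration {d e : ℕ} {u v : L} (hu : u ∈ lengthFiltration K x d)
    (hv : v ∈ lengthFiltration K x e) : ⁅u, v⁆ ∈ lengthFiltration K x (d + e) := by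
  induction hu using Submodule.span_induction with
  | mem u hu =>
    obtain ⟨a, ha, rfl⟩ := hu
    induction hv using Submodule.span_induction with
    | mem v hv =>
      obtain ⟨b, hb, rfl⟩ := hv
      exact Submodule.subset_span ⟨a * b, Nat.add_le_add ha hb, rfl⟩
    | zero => rw [lie_zero]; exact Submodule.zero_mem _
    | add u v _ _ hu hv => rw [lie_add]; exact Submodule.add_mem _ hu hv
    | smul c v _ hv => rw [lie_smul]; exact Submodule.smul_mem _ c hv
  | zero => rw [zero_lie]; exact Submodule.zero_mem _
  | add u v _ _ hu hv => rw [add_lie]; exact Submodule.add_mem _ hu hv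
  | smul c v _ hv => rw [smul_lie]; exact Submodule.smul_mem _ c hv

/-- The Lie algebra `L[X]` of polynomials with coefficients in `L`. -/
def PolyLie (K : Type*) [Field K] (L : Type*) [LieRing L] [LieAlgebra K L] : Type _ :=
  Polynomial K ⊗[K] L

noncomputable instance : LieRing (PolyLie K L) :=
  inferInstanceAs (LieRing (Polynomial K ⊗[K] L))

noncomputable instance : LieAlgebra K (PolyLie K L) :=
  inferInstanceAs (LieAlgebra K (Polynomial K ⊗[K] L))

/-- The element `y X ^ d` of `L[X]`. -/
noncomputable def polyMonomial (K : Type*) [Field K] {L : Type*} [LieRing L] [LieAlgebra K L]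
    (d : ℕ) (y : L) : PolyLie K L :=
  (Polynomial.X ^ d : Polynomial K) ⊗ₜ[K] y

theorem polyMonomial_zero (d : ℕ) : polyMonomial K d (0 : L) = 0 :=
  TensorProduct.tmul_zero _ _

theorem lie_polyMonomial (d e : ℕ) (u v : L) :
    ⁅polyMonomial K d u, polyMonomial K e v⁆ = polyMonomial K (d + e) ⁅u, v⁆ := by
  rw [polyMonomial, polyMonomial, polyMonomial, pow_add]
  exact LieAlgebra.ExtendScalars.bracket_tmul _ _ _ _ _ _ _ _

/-- The coefficient of `X ^ l`. -/
noncomputable def polyCoeff (K : Type*) [Field K] (L : Type*) [LieRing L] [LieAlgebra K L]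
    (l : ℕ) : PolyLie K L →ₗ[K] L :=
  ((TensorProduct.lid K L).toLinearMap ∘ₗ (Polynomial.lcoeff K l).rTensor L :
    Polynomial K ⊗[K] L →ₗ[K] L)

theorem polyCoeff_polyMonomial (l d : ℕ) (y : L) :
    polyCoeff K L l (polyMonomial K d y) = if l = d then y else 0 := by
  change ((TensorProduct.lid K L).toLinearMap ∘ₗ (Polynomial.lcoeff K l).rTensor L)
    ((Polynomial.X ^ d : Polynomial K) ⊗ₜ[K] y) = _
  simp [Polynomial.coeff_X_pow]

/-- The subspace `∑ X^(d + e) ⊗ Fil_d` of `L[X]`. -/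
noncomputable def reesSubmodule (K : Type*) [Field K] [LieAlgebra K L] (x : V → L) (e : ℕ) :
    Submodule K (PolyLie K L) :=
  Submodule.span K {v | ∃ d, ∃ y ∈ lengthFiltration K x d,
    v = polyMonomial K (d + e) y}

theorem lie_mem_reesSubmodule {d e : ℕ} {u v : PolyLie K L}
    (hu : u ∈ reesSubmodule K x d) (hv : v ∈ reesSubmodule K x e) :
    ⁅u, v⁆ ∈ reesSubmodule K x (d + e) := by
  induction hu using Submodule.span_induction with
  | mem u hu =>
    obtain ⟨a, s, ha, rfl⟩ := hu
    induction hv using Submodule.span_induction with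
    | mem v hv =>
      obtain ⟨b, t, hb, rfl⟩ := hv
      rw [lie_polyMonomial]
      exact Submodule.subset_span ⟨a + b, _, lie_mem_lengthFiltration ha hb, by congr 1; omega⟩
    | zero => rw [lie_zero]; exact Submodule.zero_mem _
    | add u v _ _ hu hv => rw [lie_add]; exact Submodule.add_mem _ hu hv
    | smul c v _ hv => rw [lie_smul]; exact Submodule.smul_mem _ c hv
  | zero => rw [zero_lie]; exact Submodule.zero_mem _
  | add u v _ _ hu hv => rw [add_lie]; exact Submodule.add_mem _ hu hv
  | smul c v _ hv => rw [smul_lie]; exact Submodule.smul_mem _ c hv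

/-- The Rees algebra of the length filtration. -/
noncomputable def lieReesAlgebra (K : Type*) [Field K] [LieAlgebra K L] (x : V → L) :
    LieSubalgebra K (PolyLie K L) :=
  { reesSubmodule K x 0 with lie_mem' := fun {a b} ha hb => lie_mem_reesSubmodule (d := 0) (e := 0) (u := a) (v := b) ha hb }

/-- The ideal of the Rees algebra generated by the parameter `X`. -/
noncomputable def reesIdeal (K : Type*) [Field K] [LieAlgebra K L] (x : V → L) :
    LieIdeal K (lieReesAlgebra K x) :=
  { (reesSubmodule K x 1).comap (lieReesAlgebra K x).toSubmodule.subtype with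
    lie_mem := fun {a b} hb => by
      have := lie_mem_reesSubmodule (d := 0) (e := 1) a.2 hb
      rwa [zero_add] at this }

/-- The extra factor X costs one degree without lengthening the coefficient. This is the source of
the drop in length. -/
theorem polyCoeff_mem {l : ℕ} {v : PolyLie K L} (hv : v ∈ reesSubmodule K x 1) :
    polyCoeff K L (l + 1) v ∈ lengthFiltration K x l := by
  induction hv using Submodule.span_induction with
  | mem v hv =>
    obtain ⟨d, y, hy, rfl⟩ := hv
    rw [polyCoeff_polyMonomial]
    split_ifs with h
    · rwa [show l = d by omega]
    · exact Submodule.zero_mem _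
  | zero => rw [map_zero]; exact Submodule.zero_mem _
  | add u v _ _ hu hv => rw [map_add]; exact Submodule.add_mem _ hu hv
  | smul c v _ hv => rw [map_smul]; exact Submodule.smul_mem _ c hv

theorem gen_mem_lengthFiltration (i : V) {d : ℕ} (hd : 1 ≤ d) : x i ∈ lengthFiltration K x d :=
  Submodule.subset_span ⟨.of i, hd, rfl⟩

/-- The element `X ⊗ x_i` of the Rees algebra. -/
noncomputable def reesGen (K : Type*) [Field K] [LieAlgebra K L] (x : V → L) (i : V) :
    lieReesAlgebra K x :=
  ⟨polyMonomial K 1 (x i),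
    Submodule.subset_span ⟨1, _, gen_mem_lengthFiltration i le_rfl, rfl⟩⟩

theorem coe_monomialValue_reesGen (m : FreeMagma V) :
    (monomialValue (reesGen K x) m).1 =
      polyMonomial K m.length (monomialValue x m) := by
  induction m with
  | ih1 i => rfl
  | ih2 a b iha ihb =>
    change ⁅(monomialValue (reesGen K x) a).1, (monomialValue (reesGen K x) b).1⁆ = _
    rw [iha, ihb, lie_polyMonomial]
    rfl

theorem coe_wordValue_reesGen (w : List V) :
    (wordValue (reesGen K x) w).1 =
      polyMonomial K w.length (wordValue x w) := by
  induction w with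
  | nil => exact (polyMonomial_zero _).symm
  | cons i w ih =>
    cases w with
    | nil => rfl
    | cons j w =>
      change ⁅polyMonomial K 1 (x i),
        (wordValue (reesGen K x) (j :: w)).1⁆ = _
      rw [ih, lie_polyMonomial, add_comm]
      rfl

/-- Two brackets by X x_i turn y X^d into f_i(y) x_i X^(d+2). Since x_i already has length at most d
+ 1, a factor X is left over. -/
theorem degenerate_reesGen {Γ : SimpleGraph V} (f : V → L → K)
    (hc : ∀ i j, ¬Γ.Adj i j → ⁅x i, x j⁆ = 0) (hf : ∀ i v, ⁅x i, ⁅x i, v⁆⁆ = f i v • x i) :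
    Degenerate Γ fun i => (LieSubmodule.Quotient.mk (reesGen K x i) :
      lieReesAlgebra K x ⧸ reesIdeal K x) := by
  constructor
  · intro i j h
    rw [← LieSubmodule.Quotient.mk_bracket]
    have : ⁅reesGen K x i, reesGen K x j⁆ = 0 := by
      refine Subtype.ext ?_
      change ⁅polyMonomial K 1 (x i), polyMonomial K 1 (x j)⁆ = 0
      rw [lie_polyMonomial, hc i j h, polyMonomial_zero]
    rw [this]
    rfl
  · intro i v
    obtain ⟨v, rfl⟩ := LieSubmodule.Quotient.surjective_mk' _ v
    rw [LieSubmodule.Quotient.mk'_apply, ← LieSubmodule.Quotient.mk_bracket,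
      ← LieSubmodule.Quotient.mk_bracket]
    refine LieSubmodule.Quotient.mk_eq_zero'.2 ?_
    change ⁅polyMonomial K 1 (x i), ⁅polyMonomial K 1 (x i),
      v.1⁆⁆ ∈ reesSubmodule K x 1
    obtain ⟨v, hv⟩ := v
    change v ∈ reesSubmodule K x 0 at hv
    change ⁅_, ⁅_, v⁆⁆ ∈ _
    induction hv using Submodule.span_induction with
    | mem v hv =>
      obtain ⟨d, y, -, rfl⟩ := hv
      rw [lie_polyMonomial, lie_polyMonomial, hf]
      refine Submodule.subset_span ⟨d + 1, f i y • x i, Submodule.smul_mem _ _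
        (gen_mem_lengthFiltration i (by omega)), ?_⟩
      congr 1; omega
    | zero => simp
    | add u v _ _ hu hv => rw [lie_add, lie_add]; exact Submodule.add_mem _ hu hv
    | smul c v _ hv => rw [lie_smul, lie_smul]; exact Submodule.smul_mem _ c hv

/-- If the monomials in degenerate generators are combinations of words from `M`, then monomials in
extremal generators are combinations of words from `M` that are not longer. -/
theorem lengthFiltration_le_of_spansDegenerate {Γ : SimpleGraph V} {M : Set (List V)}
    (hM : SpansDegenerate K Γ M (lieReesAlgebra K x ⧸ reesIdeal K x)) (f : V → L → K)
    (hc : ∀ i j, ¬Γ.Adj i j → ⁅x i, x j⁆ = 0) (hf : ∀ i v, ⁅x i, ⁅x i, v⁆⁆ = f i v • x i) (l : ℕ) :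
    lengthFiltration K x l ≤
      Submodule.span K {z | ∃ w ∈ M, w.length ≤ l ∧ z = wordValue x w} := by
  induction l with
  | zero =>
    refine Submodule.span_le.2 ?_
    rintro _ ⟨m, hm, rfl⟩
    exact absurd m.length_pos (by omega)
  | succ l ih =>
    replace ih := ih.trans (Submodule.span_mono (t :=
      {z | ∃ w ∈ M, w.length ≤ l + 1 ∧ z = wordValue x w})
      fun _ ⟨w, hw, h, e⟩ => ⟨w, hw, h.trans l.le_succ, e⟩)
    refine Submodule.span_le.2 ?_
    rintro _ ⟨m, hm, rfl⟩
    rcases hm.lt_or_eq with hm | hm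
    · exact ih (lengthFiltration_mono (Nat.le_of_lt_succ hm) (monomialValue_mem_lengthFiltration m))
    let π := LieSubmodule.Quotient.mk' (reesIdeal K x)
    have hπ (a b : lieReesAlgebra K x) : π ⁅a, b⁆ = ⁅π a, π b⁆ := LieSubmodule.Quotient.mk_bracket (I := reesIdeal K x) a b
    have h := hM _ (degenerate_reesGen f hc hf) m
    rw [show (fun i => LieSubmodule.Quotient.mk (reesGen K x i)) = π ∘ reesGen K x from rfl,
      ← map_monomialValue π hπ, show wordValue (π ∘ reesGen K x) =
        fun w => (π : lieReesAlgebra K x →ₗ[K] _) (wordValue (reesGen K x) w) from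
        funext fun w => (map_wordValue π hπ _ w).symm, ← Set.image_image, Submodule.span_image] at h
    obtain ⟨s, hs, h⟩ := h
    replace h : monomialValue (reesGen K x) m - s ∈ reesIdeal K x := by
      rw [← LieSubmodule.Quotient.mk_eq_zero']
      exact sub_eq_zero.2 h.symm
    replace h : (monomialValue (reesGen K x) m).1 - s.1 ∈ reesSubmodule K x 1 := h
    -- Taking the coefficient of X^(l+1) leaves an error in filtration degree l, where the induction
    -- hypothesis applies.
    replace h := ih (polyCoeff_mem (l := l) h)
    rw [map_sub, coe_monomialValue_reesGen, polyCoeff_polyMonomial, if_pos hm.symm] at h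
    refine (Submodule.sub_mem_iff_left _ ?_).1 h
    clear h
    induction hs using Submodule.span_induction with
    | mem v hv =>
      obtain ⟨w, hw, rfl⟩ := hv
      rw [coe_wordValue_reesGen, polyCoeff_polyMonomial]
      -- Only words of length exactly l + 1 contribute to this coefficient; that is why the length
      -- bound holds although the spanning statement in the quotient carries none.
      split_ifs with e
      · exact Submodule.subset_span ⟨w, hw, e.ge, rfl⟩
      · exact Submodule.zero_mem _
    | zero => rw [ZeroMemClass.coe_zero, map_zero]; exact Submodule.zero_mem _
    | add u v _ _ hu hv =>
      exact (map_add (polyCoeff K L _) u.1 v.1).symm ▸ Submodule.add_mem _ hu hv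
    | smul c v _ hv => exact (map_smul (polyCoeff K L _) c v.1).symm ▸ Submodule.smul_mem _ c hv

theorem spansMonomialsByLength_of_spansDegenerate.{u} {K : Type u} [Field K] {V : Type}
    {Γ : SimpleGraph V} {M : Set (List V)}
    (hM : ∀ (G : Type u) [LieRing G] [LieAlgebra K G], SpansDegenerate K Γ M G) :
    SpansMonomialsByLength K Γ M := by
  intro f m
  refine lengthFiltration_le_of_spansDegenerate (Γ := Γ) (hM _)
    -- The functional f_i lives on F_Γ and need not descend to the quotient. Any choice of preimages
    -- serves, as only the relation for each single v is used.
    (fun i v => f i (Function.surjInv (LieSubmodule.Quotient.surjective_mk' _) v)) ?_ ?_ m.length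
    (monomialValue_mem_lengthFiltration m)
  · intro i j h
    have e : ⁅graphGen K Γ i, graphGen K Γ j⁆ = 0 :=
      (LieSubmodule.Quotient.mk_eq_zero' (N := commutationIdeal K Γ)).2
        (LieSubmodule.subset_lieSpan ⟨i, j, h, rfl⟩)
    change (LieSubmodule.Quotient.mk ⁅graphGen K Γ i, graphGen K Γ j⁆ : ExtremalLie K Γ f) = 0
    rw [e]
    rfl
  · intro i v
    have e := Function.surjInv_eq (LieSubmodule.Quotient.surjective_mk' (extremalIdeal K Γ f)) v
    generalize Function.surjInv (LieSubmodule.Quotient.surjective_mk' (extremalIdeal K Γ f)) v = y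
      at e ⊢
    subst e
    exact sub_eq_zero.1 ((LieSubmodule.Quotient.mk_eq_zero' (N := extremalIdeal K Γ f)).2
      (LieSubmodule.subset_lieSpan ⟨i, y, rfl⟩))

end Rees

/-! ### Conclusion for the four types -/

theorem mainTheorem10 {𝔽 : Type*} [Field 𝔽] [IsAlgClosed 𝔽] (h2 : ringChar 𝔽 ≠ 2) :
    (∀ n : ℕ, 5 ≤ n →
      (monomialsD n).ncard = 2 * n ^ 2 - n ∧
      SpansMonomialsByLength 𝔽 (graphD n) (monomialsD n)) ∧
    (∀ n : ℕ, 5 ≤ n →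
      (monomialsB n).ncard = 2 * n ^ 2 - 3 * n + 1 ∧
      SpansMonomialsByLength 𝔽 (graphB n) (monomialsB n)) ∧
    (∀ n : ℕ, 2 ≤ n → SpansMonomialsByLength 𝔽 (graphA n) (monomialsA n)) ∧
    (∀ n : ℕ, 1 ≤ n → SpansMonomialsByLength 𝔽 (graphC n) (monomialsC n)) := by
  refine ⟨fun n hn => ?_, fun n hn => ?_, fun n _ => ?_, fun n _ => ?_⟩
  · obtain ⟨p, rfl⟩ := Nat.exists_eq_add_of_le' (show 2 ≤ n by omega)
    have hp : 3 ≤ p := by omega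
    refine ⟨?_, spansMonomialsByLength_of_spansDegenerate fun _ => spansDegenerate_graphD h2 hp⟩
    rw [monomialsD, ncard_onVertices, ncard_wordsD hp]
    · have : 2 * (p + 2) ^ 2 = 2 * p ^ 2 + 8 * p + 8 := by ring
      omega
    · intro w hw a ha
      obtain ⟨c, k, i, h, rfl⟩ := (mem_wordsD_iff hp).1 hw
      exact letters_codeWord hp h ha
  · obtain ⟨p, rfl⟩ := Nat.exists_eq_add_of_le' (show 2 ≤ n by omega)
    have hp : 3 ≤ p := by omega
    refine ⟨?_, spansMonomialsByLength_of_spansDegenerate fun _ => spansDegenerate_graphB h2 hp⟩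
    rw [monomialsB, ncard_onVertices, ncard_wordsB hp]
    · have : 2 * (p + 2) ^ 2 = 2 * p ^ 2 + 8 * p + 8 := by ring
      omega
    · intro w hw a ha
      obtain ⟨c, k, i, h, -, rfl⟩ := (mem_wordsB_iff hp).1 hw
      exact letters_codeWord hp h ha
  · exact spansMonomialsByLength_of_spansDegenerate fun _ => spansDegenerate_graphA h2
  · exact spansMonomialsByLength_of_spansDegenerate fun _ => spansDegenerate_graphC h2
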